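/- All graphs are simple and finite, and equality of graphs means isomorphism. The line graph $L(H)$ of a graph $H$ has the edges of $H$ as its vertices, two of them being adjacent when they are distinct and share an endpoint; $L^1(H)=L(H)$ and $L^{n}(H)=L(L^{n-1}(H))$ for $n\ge 2$. Let $K_4-e$ denote the complete graph on four vertices with one edge removed. Let - $G_1=K_{1,3}$; - $G_2$ be the graph obtained from $K_4-e$ by adding one new vertex adjacent exactly to the two nonadjacent vertices of $K_4-e$; - $G_4$ be the graph obtained from $K_4-e$ by attaching one pendant vertex to each of its two nonadjacent vertices; - $G_7$ be the graph obtained from $G_4$ by joining its two pendant vertices by an edge; - $L_{1,n}$ ($n\ge 1$) be the graph obtained from a path $v_1,\dots,v_n$ on $n$ vertices by identifying $v_1$ with a vertex of degree two of a copy of $K_4-e$; - $L_{2,n}$ ($n\ge 2$) be the graph obtained from a path $v_1,\dots,v_n$ on $n$ vertices by identifying $v_1$ with a vertex of degree two of one copy of $K_4-e$, and $v_n$ with a vertex of degree two of another, disjoint copy of $K_4-e$. **Theorem.** Let $G$ be a connected graph with maximum degree $\Delta(G)=3$ and $G\ne G_2$. Then: (a) $G=L(H)$ for some graph $H$ if and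 only if $G$ contains none of $G_1,G_4,G_7$ as an induced subgraph. (b) $G=L^2(H)$ for some graph $H$ if and only if $G$ is isomorphic to $L_{k,n}$ for some $k\in\{1,2\}$ and some $n\ge k$. (c) For every $n\ge 3$ and every graph $H$, $G\ne L^n(H)$. Moreover, (a) and (b) remain true if $H$ is required to be connected. -/

import Mathlib

namespace IterLine

/-- The `n`-th iterated line graph of `H`, bundled with its vertex type:
`L^0(H) = H` and `L^(n+1)(H) = L(L^n(H))`. -/
def bundled {W : Type*} (H : SimpleGraph W) : ℕ → Σ U : Type _, SimpleGraph U
  | 0 => ⟨W, H⟩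
  | n + 1 => ⟨(bundled H n).2.edgeSet, (bundled H n).2.lineGraph⟩

/-- The `n`-th iterated line graph `L^n(H)`. -/
def iterLineGraph {W : Type*} (H : SimpleGraph W) (n : ℕ) : SimpleGraph (bundled H n).1 :=
  (bundled H n).2

theorem iterLineGraph_one {W : Type*} (H : SimpleGraph W) :
    iterLineGraph H 1 = H.lineGraph := rfl

theorem iterLineGraph_succ {W : Type*} (H : SimpleGraph W) (n : ℕ) :
    iterLineGraph H (n + 1) = (iterLineGraph H n).lineGraph := rfl

/-- `G` is (isomorphic to) `L^n(H)` for some finite simple graph `H`. -/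
def IsIterLineGraph {V : Type*} (n : ℕ) (G : SimpleGraph V) : Prop :=
  ∃ (W : Type) (_ : Finite W) (H : SimpleGraph W), Nonempty (G ≃g iterLineGraph H n)

/-- `G` is (isomorphic to) `L^n(H)` for some finite connected simple graph `H`. -/
def IsIterLineGraphOfConnected {V : Type*} (n : ℕ) (G : SimpleGraph V) : Prop :=
  ∃ (W : Type) (_ : Finite W) (H : SimpleGraph W),
    H.Connected ∧ Nonempty (G ≃g iterLineGraph H n)

/-- The claw `K_{1,3}`. -/
def G₁ : SimpleGraph (Fin 1 ⊕ Fin 3) := completeBipartiteGraph (Fin 1) (Fin 3)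

/-- The diamond `K₄ - e` on `0, 1, 2, 3` (with `2, 3` nonadjacent), and a further vertex `4`
adjacent exactly to `2` and `3`. -/
def G₂ : SimpleGraph (Fin 5) :=
  SimpleGraph.fromEdgeSet {s(0, 1), s(0, 2), s(0, 3), s(1, 2), s(1, 3), s(2, 4), s(3, 4)}

/-- The diamond on `0, 1, 2, 3` (with `2, 3` nonadjacent), with a pendant vertex attached to each
of the two nonadjacent vertices. -/
def G₄ : SimpleGraph (Fin 6) :=
  SimpleGraph.fromEdgeSet {s(0, 1), s(0, 2), s(0, 3), s(1, 2), s(1, 3), s(2, 4), s(3, 5)}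

/-- The graph obtained from `G₄` by joining its two pendant vertices. -/
def G₇ : SimpleGraph (Fin 6) :=
  SimpleGraph.fromEdgeSet
    {s(0, 1), s(0, 2), s(0, 3), s(1, 2), s(1, 3), s(2, 4), s(3, 5), s(4, 5)}

/-- The graph `L_{k,n}`, for `k ∈ {1, 2}` and `n ≥ k`: a path `v₁, …, vₙ` on `n` vertices, with
`v₁` (and, if `k = 2`, also `vₙ`) identified with a vertex of degree two of a diamond `K₄ - e`,
the diamonds being otherwise disjoint from each other and from the path.
The vertices are numbered consecutively: `vᵢ` is vertex `i + 2`; the first diamond is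
`{0, 1, 2, 3}`, without the edge `{0, 3}`; the second, present if `k = 2`, is
`{n + 2, n + 3, n + 4, n + 5}`, without the edge `{n + 2, n + 5}`. -/
def L (k n : ℕ) : SimpleGraph (Fin (n + 3 * k)) :=
  SimpleGraph.fromRel fun i j =>
    j.val = i.val + 1 ∨
    (i.val = 0 ∧ j.val = 2) ∨ (i.val = 1 ∧ j.val = 3) ∨
    (k = 2 ∧ ((i.val = n + 2 ∧ j.val = n + 4) ∨ (i.val = n + 3 ∧ j.val = n + 5)))

end IterLine

/-! For (a), let two edges `xa`, `xb` be the centres of an induced diamond in a line graph. The tips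
are not both edges through `x`, so one of them is `ab`, and every edge meeting `ab` meets `xa` or
`xb`. Hence the two tips cannot both have a neighbour that misses both centres, as they do in `G₄`
and `G₇`. Claws are excluded because an edge has only two ends.

Conversely, Krausz's criterion asks for a partition of the edges into cliques, at most two through
each vertex. The cliques are the triangles not containing a degree-two tip of a diamond, and the
edges outside these triangles. The forbidden subgraphs give every induced diamond a degree-two tip
(`Diamond.tip_or_tip`), so the chosen triangles are edge-disjoint. `K₄` and the diamond itself are
treated directly.

For (b), a degree-three vertex of `L(X)` with `X` claw-free comes from a triangle of `X` with a
further edge at one corner, hence lies in a diamond of `L(X)`. The degree bound forces one tip of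
this diamond to have degree two. A longest path growing out of such a diamond either stops, giving
`L 1 n`, or runs into a second diamond, giving `L 2 n`. In the other direction, `L k n` is the
second line graph of a path with forked ends.

For (c), the same triangle puts a diamond in `L²`, and the edge joining its centres has four
neighbours in `L³`. -/

open SimpleGraph

/-! ### Recognising line graphs by edge labels; isolated vertices of the root -/

namespace SimpleGraph

variable {V W : Type*}

/-- A graph whose adjacency is intersection of distinct edges, for an injective labelling of its
vertices by the edges of some graph, is the line graph of the graph formed by the labels. -/
theorem nonempty_iso_lineGraph_of_sym2 {G : SimpleGraph V} (φ : V → Sym2 W)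
    (hinj : Function.Injective φ) (hdiag : ∀ v, ¬ (φ v).IsDiag)
    (hadj : ∀ v w, v ≠ w → (G.Adj v w ↔ ∃ x, x ∈ φ v ∧ x ∈ φ w)) :
    Nonempty (G ≃g (fromEdgeSet (Set.range φ)).lineGraph) := by
  have hmem : ∀ v, φ v ∈ (fromEdgeSet (Set.range φ)).edgeSet := fun v => by
    rw [edgeSet_fromEdgeSet]
    exact ⟨⟨v, rfl⟩, hdiag v⟩
  refine ⟨⟨Equiv.ofBijective (fun v => ⟨φ v, hmem v⟩) ⟨?_, ?_⟩, ?_⟩⟩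
  · intro v w h
    exact hinj (Subtype.ext_iff.mp h)
  · rintro ⟨e, he⟩
    rw [edgeSet_fromEdgeSet] at he
    obtain ⟨⟨v, rfl⟩, -⟩ := he
    exact ⟨v, rfl⟩
  · intro v w
    simp only [lineGraph_adj_iff_exists, ne_eq]
    constructor
    · rintro ⟨h, hx⟩
      exact (hadj v w fun e => h (by rw [e])).2 hx
    · intro h
      exact ⟨fun e => h.ne (hinj (Subtype.ext_iff.mp e)), (hadj v w h.ne).1 h⟩

/-- An induced subgraph of a line graph is a line graph. -/
theorem nonempty_induce_lineGraph_iso (H : SimpleGraph W) (s : Set H.edgeSet) :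
    ∃ H' : SimpleGraph W, Nonempty (H.lineGraph.induce s ≃g H'.lineGraph) :=
  ⟨_, nonempty_iso_lineGraph_of_sym2 (fun e : s => (e.1.1 : Sym2 W))
    (fun _ _ h => Subtype.ext (Subtype.ext h)) (fun e => H.not_isDiag_of_mem_edgeSet e.1.2)
    (fun v w h => by
      have h' : v.1 ≠ w.1 := fun e => h (Subtype.ext e)
      simp [lineGraph_adj_iff_exists, h'])⟩

/-- Removing isolated vertices does not change the line graph. -/
theorem nonempty_lineGraph_induce_support_iso (H : SimpleGraph W) :
    Nonempty ((H.induce H.support).lineGraph ≃g H.lineGraph) := by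
  refine ⟨RelIso.ofSurjective
    (Copy.toLineGraphEmbedding (Embedding.induce (G := H) H.support).toCopy) ?_⟩
  rintro ⟨e, he⟩
  induction e using Sym2.ind with
  | _ a b =>
    have hab : H.Adj a b := he
    exact ⟨⟨s(⟨a, b, hab⟩, ⟨b, a, hab.symm⟩), hab⟩, rfl⟩

/-- If the line graph is connected, so is the graph without its isolated vertices. -/
theorem connected_induce_support (H : SimpleGraph W) (hc : H.lineGraph.Connected) :
    (H.induce H.support).Connected := by
  have key : ∀ e f : H.edgeSet, H.lineGraph.Reachable e f → ∀ u v : H.support,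
      u.1 ∈ e.1 → v.1 ∈ f.1 → (H.induce H.support).Reachable u v := by
    have base : ∀ e : H.edgeSet, ∀ u v : H.support, u.1 ∈ e.1 → v.1 ∈ e.1 →
        (H.induce H.support).Reachable u v := by
      rintro ⟨e, he⟩ u v hu hv
      by_cases huv : u = v
      · subst huv; exact Reachable.refl _
      · have : e = s(u.1, v.1) := (Sym2.mem_and_mem_iff fun h => huv (Subtype.ext h)).1 ⟨hu, hv⟩
        subst this
        exact Adj.reachable he
    rintro e f ⟨p⟩
    induction p with
    | nil => exact base _
    | cons h p ih =>
      intro u v hu hv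
      obtain ⟨-, x, hx1, hx2⟩ := lineGraph_adj_iff_exists.1 h
      have hx : x ∈ H.support := by
        rename_i e1 e2 e3
        obtain ⟨e1, he1⟩ := e1
        obtain ⟨y, rfl⟩ := hx1
        exact ⟨y, he1⟩
      exact (base _ u ⟨x, hx⟩ hu hx1).trans (ih ⟨x, hx⟩ v hx2 hv)
  have : Nonempty H.support := by
    obtain ⟨⟨e, he⟩⟩ := hc.nonempty
    induction e using Sym2.ind with
    | _ a b => exact ⟨⟨a, b, he⟩⟩
  refine ⟨fun u v => ?_⟩
  obtain ⟨u', hu⟩ := u.2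
  obtain ⟨v', hv⟩ := v.2
  exact key ⟨s(u, u'), hu⟩ ⟨s(v, v'), hv⟩ (hc.preconnected _ _) u v
    (Sym2.mem_mk_left _ _) (Sym2.mem_mk_left _ _)

theorem finite_support (H : SimpleGraph W) [Finite H.edgeSet] : H.support.Finite := by
  have : H.support ⊆ ⋃ e ∈ H.edgeSet, {x | x ∈ e} := by
    rintro x ⟨y, h⟩
    simp only [Set.mem_iUnion]
    exact ⟨s(x, y), h, Sym2.mem_mk_left _ _⟩
  refine ((Set.toFinite H.edgeSet).biUnion fun e _ => ?_).subset this
  induction e using Sym2.ind with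
  | _ a b =>
    refine (Set.toFinite {a, b}).subset fun x hx => ?_
    simpa using hx

end SimpleGraph

/-! ### From arbitrary roots to finite connected roots -/

namespace IterLine

variable {V W : Type*}

/-- The given root may be infinite and in any universe. Its support carries the same line graph, is
finite because `G` has finitely many vertices, and is moved to some `Fin n`. -/
theorem isIterLineGraphOfConnected_one [Finite V] {G : SimpleGraph V} (hG : G.Connected)
    {H : SimpleGraph W} (h : Nonempty (G ≃g H.lineGraph)) :
    IsIterLineGraphOfConnected 1 G := by
  obtain ⟨i⟩ := h
  have : Finite H.edgeSet := Finite.of_equiv V i.toEquiv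
  have : Finite H.support := H.finite_support
  obtain ⟨n, ⟨e⟩⟩ := Finite.exists_equiv_fin H.support
  have hc := H.connected_induce_support (i.connected_iff.1 hG)
  obtain ⟨j⟩ := H.nonempty_lineGraph_induce_support_iso
  let k := Iso.map e (H.induce H.support)
  exact ⟨Fin n, inferInstance, _, k.connected_iff.1 hc, ⟨(i.trans j.symm).trans k.lineGraph⟩⟩

/-- Isolated vertices have to be dropped from `L(H)` rather than from `H`. What remains is an
induced subgraph of a line graph, hence a connected line graph, and the one-step case applies to it.
-/
theorem isIterLineGraphOfConnected_two [Finite V] {G : SimpleGraph V} (hG : G.Connected)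
    {H : SimpleGraph W} (h : Nonempty (G ≃g H.lineGraph.lineGraph)) :
    IsIterLineGraphOfConnected 2 G := by
  obtain ⟨i⟩ := h
  have : Finite H.lineGraph.edgeSet := Finite.of_equiv V i.toEquiv
  have : Finite H.lineGraph.support := H.lineGraph.finite_support
  have hc := H.lineGraph.connected_induce_support (i.connected_iff.1 hG)
  obtain ⟨j⟩ := H.lineGraph.nonempty_lineGraph_induce_support_iso
  obtain ⟨H', hH'⟩ := H.nonempty_induce_lineGraph_iso H.lineGraph.support
  obtain ⟨U, hU, K, hK, ⟨k⟩⟩ := isIterLineGraphOfConnected_one hc hH'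
  exact ⟨U, hU, K, hK, ⟨(i.trans j.symm).trans (Iso.lineGraph k)⟩⟩

end IterLine

/-! ### Necessity of the forbidden subgraphs -/

namespace SimpleGraph

variable {V W : Type*}

/-- Among any three neighbours of a vertex, two are adjacent. -/
def ClawFree (G : SimpleGraph V) : Prop :=
  ∀ ⦃g a b c⦄, G.Adj g a → G.Adj g b → G.Adj g c → a ≠ b → a ≠ c → b ≠ c →
    G.Adj a b ∨ G.Adj a c ∨ G.Adj b c

theorem isIndContained_iff {G : SimpleGraph V} {K : SimpleGraph W} :
    K.IsIndContained G ↔ ∃ f : W → V, Function.Injective f ∧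
      ∀ x y, G.Adj (f x) (f y) ↔ K.Adj x y :=
  ⟨fun ⟨f⟩ => ⟨f, f.injective, fun _ _ => f.map_adj_iff⟩,
    fun ⟨f, hf, h⟩ => ⟨⟨⟨f, hf⟩, h _ _⟩⟩⟩

theorem clawFree_iff (G : SimpleGraph V) : G.ClawFree ↔ ¬ IterLine.G₁.IsIndContained G := by
  rw [isIndContained_iff]
  constructor
  · rintro h ⟨f, hf, e⟩
    have := @h (f (.inl 0)) (f (.inr 0)) (f (.inr 1)) (f (.inr 2))
    simp [e, IterLine.G₁, hf.eq_iff] at this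
  · intro h g a b c ha hb hc hab hac hbc
    by_contra! hn
    obtain ⟨h1, h2, h3⟩ := hn
    refine h ⟨Sum.elim (fun _ => g) ![a, b, c], ?_, ?_⟩
    · rintro (i | i) (j | j) <;> fin_cases i <;> fin_cases j <;>
        simp [ha.ne, ha.ne', hb.ne, hb.ne', hc.ne, hc.ne', hab, hab.symm, hac, hac.symm, hbc,
          hbc.symm]
    · rintro (i | i) (j | j) <;> fin_cases i <;> fin_cases j <;>
        simp [IterLine.G₁, ha, hb, hc, h1, h2, h3, ha.symm, hb.symm, hc.symm, G.adj_comm b a,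
          G.adj_comm c a, G.adj_comm c b]

theorem ClawFree.of_embedding {G : SimpleGraph V} {H : SimpleGraph W} (h : H.ClawFree)
    (f : G ↪g H) : G.ClawFree := by
  intro g a b c ha hb hc hab hac hbc
  simpa using h (f.map_adj_iff.2 ha) (f.map_adj_iff.2 hb) (f.map_adj_iff.2 hc)
    (f.injective.ne hab) (f.injective.ne hac) (f.injective.ne hbc)

/-- By pigeonhole, two of three edges meeting `g` do so at the same endpoint of `g`. -/
theorem clawFree_lineGraph (H : SimpleGraph W) : H.lineGraph.ClawFree := by
  rintro ⟨g, hg⟩ a b c ha hb hc hab hac hbc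
  simp only [lineGraph_adj_iff_exists, hab, hac, hbc, ne_eq, not_false_eq_true, true_and]
    at ha hb hc ⊢
  obtain ⟨-, x, hx, hxa⟩ := ha
  obtain ⟨-, y, hy, hyb⟩ := hb
  obtain ⟨-, z, hz, hzc⟩ := hc
  induction g using Sym2.ind with
  | _ u v =>
    simp only [Sym2.mem_iff] at hx hy hz
    grind

/-- Both triangles of an induced diamond being odd is impossible in a line graph. -/
theorem lineGraph_diamond (H : SimpleGraph W) {q r p s t u : H.edgeSet}
    (hqr : H.lineGraph.Adj q r) (hqp : H.lineGraph.Adj q p) (hqs : H.lineGraph.Adj q s)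
    (hrp : H.lineGraph.Adj r p) (hrs : H.lineGraph.Adj r s) (hps : ¬ H.lineGraph.Adj p s)
    (hne : p ≠ s)
    (htp : H.lineGraph.Adj p t) (htq : ¬ H.lineGraph.Adj q t) (htr : ¬ H.lineGraph.Adj r t)
    (hus : H.lineGraph.Adj s u) (huq : ¬ H.lineGraph.Adj q u) (hur : ¬ H.lineGraph.Adj r u) :
    False := by
  have htq' : q ≠ t := by rintro rfl; exact htr hqr.symm
  have htr' : r ≠ t := by rintro rfl; exact htq hqr
  have huq' : q ≠ u := by rintro rfl; exact hur hqr.symm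
  have hur' : r ≠ u := by rintro rfl; exact huq hqr
  obtain ⟨q, hq⟩ := q
  obtain ⟨r, hr⟩ := r
  obtain ⟨p, hp⟩ := p
  obtain ⟨s, hs⟩ := s
  simp only [lineGraph_adj_iff_exists, ne_eq, hne, htq', htr', huq', hur', not_false_eq_true,
    true_and] at *
  -- Write `q = xa`, `r = xb`. As `p` and `s` are nonadjacent, one of them avoids `x` and so equals
  -- `ab`. Its outer neighbour (`t` or `u`) then meets `q` or `r`.
  obtain ⟨h1, x, hxq, hxr⟩ := hqr
  obtain ⟨a, rfl⟩ := hxq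
  obtain ⟨b, rfl⟩ := hxr
  obtain ⟨-, hqp⟩ := hqp
  obtain ⟨-, hqs⟩ := hqs
  obtain ⟨-, hrp⟩ := hrp
  obtain ⟨-, hrs⟩ := hrs
  obtain ⟨-, htp⟩ := htp
  obtain ⟨-, hus⟩ := hus
  induction p using Sym2.ind with
  | _ p1 p2 =>
  induction s using Sym2.ind with
  | _ s1 s2 =>
    have hn1 : p1 ≠ p2 := Adj.ne hp
    have hn2 : s1 ≠ s2 := Adj.ne hs
    simp only [Sym2.mem_iff, not_exists, not_and, Subtype.mk.injEq, Sym2.eq_iff] at *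
    grind

end SimpleGraph

namespace IterLine

variable {V W : Type*}

/-- The diamond with centres `q`, `r` and tips `p`, `s` is an induced subgraph of `G`. -/
structure Diamond (G : SimpleGraph V) (p q r s : V) : Prop where
  pq : G.Adj p q
  pr : G.Adj p r
  qr : G.Adj q r
  qs : G.Adj q s
  rs : G.Adj r s
  ps : ¬ G.Adj p s
  ne : p ≠ s

/-- Only the outer neighbours `4`, `5` of the tips `2`, `3` matter. Whether they are adjacent plays
no role, so `G₇` is excluded in the same way. -/
theorem not_G₄_of_lineGraph {G : SimpleGraph V} {H : SimpleGraph W} (i : G ≃g H.lineGraph) :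
    ¬ G₄.IsIndContained G := by
  intro h
  obtain ⟨f, hf, e⟩ := isIndContained_iff.1 (h.trans ⟨i.toEmbedding⟩)
  refine H.lineGraph_diamond (q := f 0) (r := f 1) (p := f 2) (s := f 3) (t := f 4)
    (u := f 5) ?_ ?_ ?_ ?_ ?_ ?_ (hf.ne (by decide)) ?_ ?_ ?_ ?_ ?_ ?_ <;>
  simp [e, G₄]

theorem not_G₇_of_lineGraph {G : SimpleGraph V} {H : SimpleGraph W} (i : G ≃g H.lineGraph) :
    ¬ G₇.IsIndContained G := by
  intro h
  obtain ⟨f, hf, e⟩ := isIndContained_iff.1 (h.trans ⟨i.toEmbedding⟩)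
  refine H.lineGraph_diamond (q := f 0) (r := f 1) (p := f 2) (s := f 3) (t := f 4)
    (u := f 5) ?_ ?_ ?_ ?_ ?_ ?_ (hf.ne (by decide)) ?_ ?_ ?_ ?_ ?_ ?_ <;>
  simp [e, G₇]

end IterLine

/-! ### Krausz's criterion and a clique partition for subcubic claw-free graphs -/

namespace SimpleGraph

variable {V W : Type*}

/-- Used to show that an explicit list of vertices is all of `G`, once every neighbour of a listed
vertex is listed. -/
theorem Connected.mem_of_closed {G : SimpleGraph V} (hG : G.Connected) {S : Set V} {a : V}
    (ha : a ∈ S) (h : ∀ u ∈ S, ∀ v, G.Adj u v → v ∈ S) (v : V) : v ∈ S := by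
  obtain ⟨p⟩ := hG.preconnected a v
  induction p with
  | nil => exact ha
  | cons e _ ih => exact ih (h _ ha _ e)

/-- **Krausz's theorem**: a graph whose edges are partitioned by a family of cliques such that
each vertex lies in at most two of them is a line graph. -/
theorem exists_iso_lineGraph_of_cliques {G : SimpleGraph V} (K : Set (Set V))
    (hclique : ∀ k ∈ K, ∀ u ∈ k, ∀ v ∈ k, u ≠ v → G.Adj u v)
    (hcover : ∀ u v, G.Adj u v → ∃ k ∈ K, u ∈ k ∧ v ∈ k)
    (huniq : ∀ k ∈ K, ∀ l ∈ K, ∀ u v, u ≠ v → u ∈ k → v ∈ k → u ∈ l → v ∈ l → k = l)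
    (htwo : ∀ v, ∀ k ∈ K, ∀ l ∈ K, ∀ m ∈ K, v ∈ k → v ∈ l → v ∈ m → k = l ∨ k = m ∨ l = m) :
    ∃ H : SimpleGraph (Set V ⊕ V × Bool), Nonempty (G ≃g H.lineGraph) := by
  -- The root has the cliques as vertices, plus two private dummies per vertex of `G`. The label of
  -- `v` joins the cliques through `v`, padded with dummies when there are fewer than two.
  have hφ : ∀ v, ∃ e : Sym2 (Set V ⊕ V × Bool), ¬ e.IsDiag ∧
      (∀ k, Sum.inl k ∈ e ↔ k ∈ K ∧ v ∈ k) ∧ ∀ w b, Sum.inr (w, b) ∈ e → w = v := by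
    intro v
    by_cases h1 : ∃ k ∈ K, v ∈ k
    · obtain ⟨k, hk, hvk⟩ := h1
      by_cases h2 : ∃ l ∈ K, v ∈ l ∧ k ≠ l
      · obtain ⟨l, hl, hvl, hkl⟩ := h2
        refine ⟨s(.inl k, .inl l), by simpa using hkl, fun m => ?_, by simp⟩
        simp only [Sym2.mem_iff, Sum.inl.injEq]
        constructor
        · rintro (rfl | rfl) <;> exact ⟨‹_›, ‹_›⟩
        · rintro ⟨hm, hvm⟩
          rcases htwo v k hk l hl m hm hvk hvl hvm with h | h | h
          · exact absurd h hkl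
          · exact .inl h.symm
          · exact .inr h.symm
      · push Not at h2
        refine ⟨s(.inl k, .inr (v, true)), by simp, fun m => ?_, by simp +contextual⟩
        simp only [Sym2.mem_iff, Sum.inl.injEq, reduceCtorEq, or_false]
        exact ⟨fun h => h ▸ ⟨hk, hvk⟩, fun h => (h2 m h.1 h.2).symm⟩
    · push Not at h1
      refine ⟨s(.inr (v, false), .inr (v, true)), by simp, fun m => ?_, by simp +contextual⟩
      simpa using h1 m
  choose φ hd hl hr using hφ
  refine ⟨_, nonempty_iso_lineGraph_of_sym2 φ ?_ hd ?_⟩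
  · intro u v h
    by_contra hne
    have hu1 := hd u
    have hu2 := hl u
    have hu3 := hr u
    have hv2 := hl v
    have hv3 := hr v
    rw [← h] at hv2 hv3
    generalize φ u = e at *
    induction e using Sym2.ind with
    | _ x y =>
      rcases x with k | ⟨w, b⟩
      · rcases y with l | ⟨w, b⟩
        · obtain ⟨hk, huk⟩ := (hu2 k).1 (by simp)
          obtain ⟨hl, hul⟩ := (hu2 l).1 (by simp)
          obtain ⟨-, hvk⟩ := (hv2 k).1 (by simp)
          obtain ⟨-, hvl⟩ := (hv2 l).1 (by simp)
          exact hu1 (by simpa using huniq k hk l hl u v hne huk hvk hul hvl)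
        · exact hne ((hu3 w b (by simp)).symm.trans (hv3 w b (by simp)))
      · exact hne ((hu3 w b (by simp)).symm.trans (hv3 w b (by simp)))
  · intro u v hne
    constructor
    · intro h
      obtain ⟨k, hk, huk, hvk⟩ := hcover u v h
      exact ⟨.inl k, (hl u k).2 ⟨hk, huk⟩, (hl v k).2 ⟨hk, hvk⟩⟩
    · rintro ⟨k | ⟨w, b⟩, h1, h2⟩
      · obtain ⟨hk, huk⟩ := (hl u k).1 h1
        exact hclique k hk u huk v ((hl v k).1 h2).2 hne
      · exact absurd ((hr u w b h1).symm.trans (hr v w b h2)) hne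

/-- No vertex has four distinct neighbours. -/
def Subcubic (G : SimpleGraph V) : Prop :=
  ∀ ⦃v a b c d⦄, G.Adj v a → G.Adj v b → G.Adj v c → G.Adj v d →
    a ≠ b → a ≠ c → b ≠ c → d = a ∨ d = b ∨ d = c

end SimpleGraph

namespace IterLine

variable {V W : Type*} {G : SimpleGraph V}

/-- `p` has degree two and is a tip of a diamond with centres `q`, `r`. -/
def Tip (G : SimpleGraph V) (p q r : V) : Prop :=
  (∀ x, G.Adj p x → x = q ∨ x = r) ∧ ∃ s, s ≠ p ∧ G.Adj q s ∧ G.Adj r s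

/-- A triangle without a tip of degree two of a diamond. -/
structure Good (G : SimpleGraph V) (u v w : V) : Prop where
  uv : G.Adj u v
  uw : G.Adj u w
  vw : G.Adj v w
  tu : ¬ Tip G u v w
  tv : ¬ Tip G v u w
  tw : ¬ Tip G w u v

theorem Tip.swap {p q r : V} (h : Tip G p q r) : Tip G p r q :=
  ⟨fun x hx => (h.1 x hx).symm, h.2.imp fun _ hs => ⟨hs.1, hs.2.2, hs.2.1⟩⟩

theorem Good.swap {u v w : V} (h : Good G u v w) : Good G v u w :=
  ⟨h.uv.symm, h.vw, h.uw, h.tv, h.tu, fun t => h.tw t.swap⟩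

theorem Good.rotate {u v w : V} (h : Good G u v w) : Good G u w v :=
  ⟨h.uw, h.uv, h.vw.symm, fun t => h.tu t.swap, h.tw, h.tv⟩

/-- The clique of the edge `uv`: the good triangle on it, or else the edge itself. -/
def edgeClique (G : SimpleGraph V) (u v : V) : Set V := {w | w = u ∨ w = v ∨ Good G u v w}

/-- By `hu` the good triangles are edge-disjoint, so the sets `edgeClique` partition the edges.
Among three edges at a vertex, two lie in a common good triangle, which leaves at most two cliques
there. -/
theorem exists_iso_lineGraph_of_good
    (hG : G.ClawFree) (h3 : G.Subcubic)
    (hu : ∀ u v w x, Good G u v w → Good G u v x → w = x)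
    (hd : ∀ a v b c, Diamond G a v b c → Tip G a v b → ¬ Tip G c v b) :
    ∃ H : SimpleGraph (Set V ⊕ V × Bool), Nonempty (G ≃g H.lineGraph) := by
  have swap : ∀ u v, edgeClique G u v = edgeClique G v u := fun u v => by
    ext x
    have := @Good.swap V G u v x
    have := @Good.swap V G v u x
    simp only [edgeClique, Set.mem_ofPred_eq]
    tauto
  have rot : ∀ u v w, Good G u v w → edgeClique G u w = edgeClique G u v := fun u v w h => by
    ext x
    have e1 : Good G u v x → x = w := fun h' => hu _ _ _ _ h' h
    have e2 : Good G u w x → x = v := fun h' => hu _ _ _ _ h' h.rotate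
    simp only [edgeClique, Set.mem_ofPred_eq]
    constructor
    · rintro (rfl | rfl | h')
      · exact .inl rfl
      · exact .inr (.inr h)
      · exact .inr (.inl (e2 h'))
    · rintro (rfl | rfl | h')
      · exact .inl rfl
      · exact .inr (.inr h.rotate)
      · exact .inr (.inl (e1 h'))
  -- Any two vertices of a clique regenerate it. This gives both completeness and uniqueness of the
  -- clique through an edge.
  have eq : ∀ u v a b, G.Adj u v → a ∈ edgeClique G u v → b ∈ edgeClique G u v → a ≠ b →
      G.Adj a b ∧ edgeClique G a b = edgeClique G u v := by
    rintro u v a b huv (rfl | rfl | ha) (rfl | rfl | hb) hab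
    · exact absurd rfl hab
    · exact ⟨huv, rfl⟩
    · exact ⟨hb.uw, rot _ _ _ hb⟩
    · exact ⟨huv.symm, swap _ _⟩
    · exact absurd rfl hab
    · exact ⟨hb.vw, (rot _ _ _ hb.swap).trans (swap _ _)⟩
    · exact ⟨ha.uw.symm, (swap _ _).trans (rot _ _ _ ha)⟩
    · exact ⟨ha.vw.symm, (swap _ _).trans ((rot _ _ _ ha.swap).trans (swap _ _))⟩
    · exact absurd (hu _ _ _ _ ha hb) hab
  have good : ∀ v a b c, G.Adj v a → G.Adj v b → G.Adj v c → a ≠ b → a ≠ c → b ≠ c →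
      G.Adj a b → Good G v a b ∨ Good G v a c ∨ Good G v b c := by
    -- If the tip `a` spoils the triangle `v a b`, then the third neighbour `c` of `v` is the
    -- opposite tip. The triangle `v b c` is good: `v` and `b` have the extra neighbour `a`, and
    -- `hd` rules out `c`.
    have aux : ∀ v a b c, G.Adj v a → G.Adj v b → G.Adj v c → a ≠ b → a ≠ c → b ≠ c →
        G.Adj a b → Tip G a v b → Good G v b c := by
      intro v a b c ha hb hc hab hac hbc h t
      obtain ⟨s, hsa, hvs, hbs⟩ := t.2
      have hs : s = c := by
        have := h3 ha hb hc hvs hab hac hbc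
        have := hbs.ne
        grind
      subst hs
      have hnac : ¬ G.Adj a s := fun h' => by
        have := t.1 s h'
        have := hc.ne
        grind
      refine ⟨hb, hc, hbs, fun t' => ?_, fun t' => ?_,
        hd a v b s ⟨ha.symm, h, hb, hc, hbs, hnac, hac⟩ t⟩
      · have := t'.1 a ha
        grind
      · have := t'.1 a h.symm
        have := ha.ne
        grind
    intro v a b c ha hb hc hab hac hbc h
    by_contra! hn
    obtain ⟨h1, h2, h4⟩ := hn
    have ta : ¬ Tip G a v b := fun t => h4 (aux v a b c ha hb hc hab hac hbc h t)
    have tb : ¬ Tip G b v a := fun t => h2 (aux v b a c hb ha hc hab.symm hbc hac h.symm t)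
    refine h1 ⟨ha, hb, h, fun t => ?_, ta, tb⟩
    have := t.1 c hc
    grind
  have nbr : ∀ v u w, G.Adj u w → v ∈ edgeClique G u w →
      ∃ x, G.Adj v x ∧ edgeClique G u w = edgeClique G v x := by
    intro v u w huw hv
    by_cases hvu : v = u
    · exact ⟨w, hvu ▸ huw, by rw [hvu]⟩
    · obtain ⟨h, e⟩ := eq u w v u huw hv (.inl rfl) hvu
      exact ⟨u, h, e.symm⟩
  refine exists_iso_lineGraph_of_cliques {k | ∃ u v, G.Adj u v ∧ k = edgeClique G u v} ?_ ?_ ?_ ?_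
  · rintro _ ⟨u, v, huv, rfl⟩ a ha b hb hab
    exact (eq u v a b huv ha hb hab).1
  · intro u v huv
    exact ⟨_, ⟨u, v, huv, rfl⟩, .inl rfl, .inr (.inl rfl)⟩
  · rintro _ ⟨u, v, huv, rfl⟩ _ ⟨u', v', huv', rfl⟩ a b hab h1 h2 h1' h2'
    exact (eq u v a b huv h1 h2 hab).2.symm.trans (eq u' v' a b huv' h1' h2' hab).2
  · rintro v _ ⟨u1, w1, h1, rfl⟩ _ ⟨u2, w2, h2, rfl⟩ _ ⟨u3, w3, h3, rfl⟩ m1 m2 m3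
    obtain ⟨a, ha, ea⟩ := nbr _ _ _ h1 m1
    obtain ⟨b, hb, eb⟩ := nbr _ _ _ h2 m2
    obtain ⟨c, hc, ec⟩ := nbr _ _ _ h3 m3
    rw [ea, eb, ec]
    by_cases hab : a = b
    · simp [hab]
    by_cases hac : a = c
    · simp [hac]
    by_cases hbc : b = c
    · simp [hbc]
    have : Good G v a b ∨ Good G v a c ∨ Good G v b c := by
      rcases hG ha hb hc hab hac hbc with h | h | h
      · exact good v a b c ha hb hc hab hac hbc h
      · have := good v a c b ha hc hb hac hab (Ne.symm hbc) h
        have := @Good.rotate V G v c b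
        tauto
      · have := good v b c a hb hc ha hbc (Ne.symm hab) (Ne.symm hac) h
        have := @Good.rotate V G v c a
        have := @Good.rotate V G v b a
        tauto
    rcases this with h | h | h
    · exact .inl (rot _ _ _ h).symm
    · exact .inr (.inl (rot _ _ _ h).symm)
    · exact .inr (.inr (rot _ _ _ h).symm)

end IterLine

/-! ### Sufficiency of the forbidden subgraphs -/

namespace IterLine

variable {V W : Type*} {G : SimpleGraph V}

theorem injective_and_adj_iff_of_lt {n : ℕ} {K : SimpleGraph (Fin n)} (f : Fin n → V)
    (h : ∀ i j, i < j → f i ≠ f j ∧ (G.Adj (f i) (f j) ↔ K.Adj i j)) :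
    Function.Injective f ∧ ∀ i j, G.Adj (f i) (f j) ↔ K.Adj i j := by
  constructor
  · intro i j e
    by_contra hne
    rcases lt_or_gt_of_ne hne with hlt | hlt
    · exact (h i j hlt).1 e
    · exact (h j i hlt).1 e.symm
  · intro i j
    rcases lt_trichotomy i j with hlt | rfl | hlt
    · exact (h i j hlt).2
    · simp
    · rw [G.adj_comm, K.adj_comm]
      exact (h j i hlt).2

set_option maxHeartbeats 1000000 in
/-- In a connected claw-free graph other than `G₂`, with maximum degree at most three and without
induced `G₄`, `G₇`, every induced diamond has a tip of degree two. -/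
theorem Diamond.tip_or_tip {p q r s : V} (hc : G.Connected) (hG : G.ClawFree) (h3 : G.Subcubic)
    (h2 : ¬ Nonempty (G ≃g G₂)) (h4 : ¬ G₄.IsIndContained G) (h7 : ¬ G₇.IsIndContained G)
    (d : Diamond G p q r s) : Tip G p q r ∨ Tip G s q r := by
  by_contra! hn
  obtain ⟨hp, hs⟩ := hn
  obtain ⟨pq, pr, qr, qs, rs, ps, ne⟩ := d
  simp only [Tip, not_and_or] at hp hs
  replace hp := hp.resolve_right fun h => h ⟨s, ne.symm, qs, rs⟩
  replace hs := hs.resolve_right fun h => h ⟨p, ne, pq.symm, pr.symm⟩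
  push Not at hp hs
  obtain ⟨p', pp', p'q, p'r⟩ := hp
  obtain ⟨s', ss', s'q, s'r⟩ := hs
  -- The centres are saturated by the diamond, and the tips by the centres and `p'`, `s'`. So the
  -- only open questions are whether `p' = s'` and whether `p'` and `s'` are adjacent.
  have hq : ∀ x, G.Adj q x → x = p ∨ x = r ∨ x = s :=
    fun x hx => h3 pq.symm qr qs hx pr.ne ne rs.ne
  have hr : ∀ x, G.Adj r x → x = p ∨ x = q ∨ x = s :=
    fun x hx => h3 pr.symm qr.symm rs hx pq.ne ne qs.ne
  have p's : p' ≠ s := by rintro rfl; exact ps pp'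
  have s'p : s' ≠ p := by rintro rfl; exact ps ss'.symm
  have qp' : ¬ G.Adj q p' := fun h => by have := hq _ h; have := pp'.ne; grind
  have rp' : ¬ G.Adj r p' := fun h => by have := hr _ h; have := pp'.ne; grind
  have qs' : ¬ G.Adj q s' := fun h => by have := hq _ h; have := ss'.ne; grind
  have rs' : ¬ G.Adj r s' := fun h => by have := hr _ h; have := ss'.ne; grind
  have npq := pq.ne
  have npr := pr.ne
  have nqr := qr.ne
  have nqs := qs.ne
  have nrs := rs.ne
  have npp' := pp'.ne
  have nss' := ss'.ne
  have hpp : ∀ x, G.Adj p x → x = q ∨ x = r ∨ x = p' :=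
    fun x hx => h3 pq pr pp' hx nqr p'q.symm p'r.symm
  have hss : ∀ x, G.Adj s x → x = q ∨ x = r ∨ x = s' :=
    fun x hx => h3 qs.symm rs.symm ss' hx nqr s'q.symm s'r.symm
  by_cases e : p' = s'
  · subst e
    -- A third neighbour of `p'` would make a claw with `p` and `s`. The five vertices are therefore
    -- closed under adjacency and form `G₂`.
    have hp' : ∀ x, G.Adj p' x → x = p ∨ x = s := fun x hx => by
      by_contra! hn
      have := hG pp'.symm ss'.symm hx ne hn.1.symm hn.2.symm
      have := hpp x
      have := hss x
      have := hx.ne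
      have := fun e : x = q => qp' (e ▸ hx.symm)
      have := fun e : x = r => rp' (e ▸ hx.symm)
      tauto
    have hall := hc.mem_of_closed (S := {q, r, p, s, p'}) (a := q) (by simp) (by
      simp only [Set.mem_insert_iff, Set.mem_singleton_iff]
      rintro u (rfl | rfl | rfl | rfl | rfl) v h
      · have := hq v h; tauto
      · have := hr v h; tauto
      · have := hpp v h; tauto
      · have := hss v h; tauto
      · have := hp' v h; tauto)
    have key : ∀ i j, i < j → ![q, r, p, s, p'] i ≠ ![q, r, p, s, p'] j ∧
        (G.Adj (![q, r, p, s, p'] i) (![q, r, p, s, p'] j) ↔ G₂.Adj i j) := by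
      intro i j hij
      fin_cases i <;> fin_cases j <;> first
        | exact absurd hij (by decide)
        | simp [G₂, pq.symm, pr.symm, qr, qs, rs, ps, ne, pp', ss', qp', rp', npq.symm, npr.symm,
            nqr, nqs, nrs, p'q.symm, p'r.symm, npp', nss']
    obtain ⟨hinj, hadj⟩ := injective_and_adj_iff_of_lt _ key
    refine h2 ⟨Iso.symm ⟨Equiv.ofBijective _ ⟨hinj, fun v => ?_⟩, hadj _ _⟩⟩
    have := hall v
    simp only [Set.mem_insert_iff, Set.mem_singleton_iff] at this
    rcases this with rfl | rfl | rfl | rfl | rfl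
    exacts [⟨0, rfl⟩, ⟨1, rfl⟩, ⟨2, rfl⟩, ⟨3, rfl⟩, ⟨4, rfl⟩]
  · have ps' : ¬ G.Adj p s' := fun h => by have := hpp _ h; grind
    have sp' : ¬ G.Adj s p' := fun h => by have := hss _ h; grind
    by_cases a : G.Adj p' s'
    · refine h7 (isIndContained_iff.2 ⟨![q, r, p, s, p', s'], injective_and_adj_iff_of_lt _ ?_⟩)
      intro i j hij
      fin_cases i <;> fin_cases j <;> first
        | exact absurd hij (by decide)
        | simp [G₇, pq.symm, pr.symm, qr, qs, rs, ps, ne, pp', ss', qp', rp', qs', rs', ps', sp', a,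
            npq.symm, npr.symm, nqr, nqs, nrs, p'q.symm, p'r.symm, s'q.symm, s'r.symm, npp', nss',
            p's.symm, s'p.symm, e]
    · refine h4 (isIndContained_iff.2 ⟨![q, r, p, s, p', s'], injective_and_adj_iff_of_lt _ ?_⟩)
      intro i j hij
      fin_cases i <;> fin_cases j <;> first
        | exact absurd hij (by decide)
        | simp [G₄, pq.symm, pr.symm, qr, qs, rs, ps, ne, pp', ss', qp', rp', qs', rs', ps', sp', a,
            npq.symm, npr.symm, nqr, nqs, nrs, p'q.symm, p'r.symm, s'q.symm, s'r.symm, npp', nss',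
            p's.symm, s'p.symm, e]

/-- The good triangles fail in two graphs: in `K₄` they overlap, and in the lone diamond both tips
have degree two. These get explicit cliques. Otherwise, overlapping good triangles would form an
induced diamond with no degree-two tip, and a diamond with both tips of degree two would be all of
`G`. -/
theorem exists_iso_lineGraph_of_forbidden (hc : G.Connected) (hG : G.ClawFree) (h3 : G.Subcubic)
    (h2 : ¬ Nonempty (G ≃g G₂)) (h4 : ¬ G₄.IsIndContained G) (h7 : ¬ G₇.IsIndContained G) :
    ∃ H : SimpleGraph (Set V ⊕ V × Bool), Nonempty (G ≃g H.lineGraph) := by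
  by_cases hK : ∃ a b c d, G.Adj a b ∧ G.Adj a c ∧ G.Adj a d ∧ G.Adj b c ∧ G.Adj b d ∧ G.Adj c d
  · obtain ⟨a, b, c, d, ab, ac, ad, bc, bd, cd⟩ := hK
    have hall := hc.mem_of_closed (S := {a, b, c, d}) (a := a) (by simp) (by
      simp only [Set.mem_insert_iff, Set.mem_singleton_iff]
      rintro u (rfl | rfl | rfl | rfl) v h
      · have := h3 ab ac ad h bc.ne bd.ne cd.ne; tauto
      · have := h3 ab.symm bc bd h ac.ne ad.ne cd.ne; tauto
      · have := h3 ac.symm bc.symm cd h ab.ne ad.ne bd.ne; tauto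
      · have := h3 ad.symm bd.symm cd.symm h ab.ne ac.ne bc.ne; tauto)
    refine exists_iso_lineGraph_of_cliques {Set.univ} ?_ ?_ ?_ ?_
    · rintro _ - u - v - huv
      have hu := hall u
      have hv := hall v
      simp only [Set.mem_insert_iff, Set.mem_singleton_iff] at hu hv
      rcases hu with rfl | rfl | rfl | rfl <;> rcases hv with rfl | rfl | rfl | rfl <;>
        first | exact absurd rfl huv | assumption | exact Adj.symm ‹_›
    · simp
    · simp
    · simp
  push Not at hK
  by_cases hD : ∃ p q r s, Diamond G p q r s ∧ ∀ x, x = p ∨ x = q ∨ x = r ∨ x = s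
  · obtain ⟨p, q, r, s, ⟨pq, pr, qr, qs, rs, ps, ne⟩, hall⟩ := hD
    have npq := pq.ne
    have npr := pr.ne
    have nqr := qr.ne
    have nqs := qs.ne
    have nrs := rs.ne
    refine exists_iso_lineGraph_of_cliques {{p, q}, {p, r}, {q, r, s}} ?_ ?_ ?_ ?_
    · simp [pq, pr, qr, qs, rs, pq.symm, pr.symm, qr.symm, qs.symm, rs.symm]
    · intro u v h
      have := h.ne
      have := fun (e : u = p) (e' : v = s) => ps (e ▸ e' ▸ h)
      have := fun (e : u = s) (e' : v = p) => ps (e ▸ e' ▸ h.symm)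
      have := hall u
      have := hall v
      simp
      grind
    · simp only [Set.mem_insert_iff, Set.mem_singleton_iff]
      rintro k (rfl | rfl | rfl) l (rfl | rfl | rfl) u v huv <;> simp <;> grind
    · simp only [Set.mem_insert_iff, Set.mem_singleton_iff]
      rintro v k (rfl | rfl | rfl) l (rfl | rfl | rfl) m (rfl | rfl | rfl) <;> simp <;> grind
  push Not at hD
  refine exists_iso_lineGraph_of_good hG h3 ?_ ?_
  · intro u v w x h1 h2'
    by_contra hne
    have d : Diamond G w u v x := ⟨h1.uw.symm, h1.vw.symm, h1.uv, h2'.uw, h2'.vw,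
      hK u v w x h1.uv h1.uw h2'.uw h1.vw h2'.vw, hne⟩
    rcases d.tip_or_tip hc hG h3 h2 h4 h7 with t | t
    · exact h1.tw t
    · exact h2'.tw t
  · intro a v b c d t t'
    obtain ⟨y, ya, yv, yb, yc⟩ := hD a v b c d
    have := hc.mem_of_closed (S := {a, v, b, c}) (a := a) (by simp) (by
      simp only [Set.mem_insert_iff, Set.mem_singleton_iff]
      rintro u (rfl | rfl | rfl | rfl) x h
      · have := t.1 x h; tauto
      · have := h3 d.pq.symm d.qr d.qs h d.pr.ne d.ne d.rs.ne; tauto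
      · have := h3 d.pr.symm d.qr.symm d.rs h d.pq.ne d.ne d.qs.ne; tauto
      · have := t'.1 x h; tauto) y
    simp_all

end IterLine

/-! ### `L k n` as a second iterated line graph -/

theorem Sym2.exists_mem_mem_iff {α : Type*} {a b c d : α} :
    (∃ x, x ∈ s(a, b) ∧ x ∈ s(c, d)) ↔ a = c ∨ a = d ∨ b = c ∨ b = d := by
  simp only [Sym2.mem_iff]
  constructor
  · rintro ⟨x, rfl | rfl, rfl | rfl⟩ <;> simp
  · rintro (rfl | rfl | rfl | rfl)
    exacts [⟨_, .inl rfl, .inl rfl⟩, ⟨_, .inl rfl, .inr rfl⟩, ⟨_, .inr rfl, .inl rfl⟩,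
      ⟨_, .inr rfl, .inr rfl⟩]

namespace IterLine

/-- A path with a triangle at one end (`k = 1`) or at both ends (`k = 2`), whose line graph
is `L k n`. -/
def trianglePath (k n : ℕ) : SimpleGraph (Fin (n + 1 + 2 * k)) :=
  SimpleGraph.fromRel fun i j =>
    j.val = i.val + 1 ∨ (i.val = 0 ∧ j.val = 2) ∨ (k = 2 ∧ i.val = n + 2 ∧ j.val = n + 4)

/-- The smaller endpoint of the edge of the triangle path that is vertex `i` of `L k n`. -/
def edgeLo (n i : ℕ) : ℕ :=
  if i ≤ 1 then 0 else if i ≤ n + 3 then i - 1 else if i = n + 4 then n + 2 else n + 3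

/-- The larger endpoint of the edge of the triangle path that is vertex `i` of `L k n`. -/
def edgeHi (n i : ℕ) : ℕ := if i ≤ 1 then i + 1 else if i ≤ n + 3 then i else n + 4

theorem edgeLo_lt (n i : ℕ) : edgeLo n i < edgeHi n i := by
  simp only [edgeLo, edgeHi]; split_ifs <;> omega

theorem edgeHi_lt {k n i : ℕ} (hi : i < n + 3 * k) :
    edgeHi n i < n + 1 + 2 * k := by
  simp only [edgeHi]; split_ifs <;> omega

theorem edge_injective {k n i j : ℕ} (hk : k = 1 ∨ k = 2) (hi : i < n + 3 * k)
    (hj : j < n + 3 * k) (h1 : edgeLo n i = edgeLo n j) (h2 : edgeHi n i = edgeHi n j) :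
    i = j := by
  simp only [edgeLo, edgeHi] at h1 h2
  split_ifs at h1 h2 <;> omega

theorem L_adj_iff_edge {k n i j : ℕ} (hk : k = 1 ∨ k = 2) (hn : k ≤ n) (hij : i < j)
    (hj : j < n + 3 * k) :
    (j = i + 1 ∨ i = 0 ∧ j = 2 ∨ i = 1 ∧ j = 3 ∨
      k = 2 ∧ (i = n + 2 ∧ j = n + 4 ∨ i = n + 3 ∧ j = n + 5)) ↔
    edgeLo n i = edgeLo n j ∨ edgeLo n i = edgeHi n j ∨ edgeHi n i = edgeLo n j ∨
      edgeHi n i = edgeHi n j := by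
  simp only [edgeLo, edgeHi]
  split_ifs <;> (try simp only [true_or, false_or, iff_true]) <;>
    first | omega | grind

theorem exists_edge_iff {k n x y : ℕ} (hk : k = 1 ∨ k = 2) (hn : k ≤ n) (hxy : x < y)
    (hy : y < n + 1 + 2 * k) :
    (∃ i < n + 3 * k, edgeLo n i = x ∧ edgeHi n i = y) ↔
      y = x + 1 ∨ x = 0 ∧ y = 2 ∨ k = 2 ∧ x = n + 2 ∧ y = n + 4 := by
  simp only [edgeLo, edgeHi]
  constructor
  · rintro ⟨i, hi, h1, h2⟩
    split_ifs at h1 h2 <;> omega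
  · intro h
    by_cases h1 : y = 1
    · exact ⟨0, by omega, by simp; omega, by simp; omega⟩
    by_cases h2 : x = 0
    · exact ⟨1, by omega, by simp; omega, by simp; omega⟩
    by_cases h3 : y ≤ n + 3
    · exact ⟨y, by omega, by split_ifs <;> omega, by split_ifs <;> omega⟩
    by_cases h4 : x = n + 2
    · exact ⟨n + 4, by omega, by split_ifs <;> omega, by split_ifs <;> omega⟩
    · exact ⟨n + 5, by omega, by split_ifs <;> omega, by split_ifs <;> omega⟩

theorem not_edge_of_lt {k n x y : ℕ} (h : x < y) :
    ¬ (x = y + 1 ∨ y = 0 ∧ x = 2 ∨ k = 2 ∧ y = n + 2 ∧ x = n + 4) := by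
  omega

theorem nonempty_L_iso {k n : ℕ} (hk : k = 1 ∨ k = 2) (hn : k ≤ n) :
    Nonempty (L k n ≃g (trianglePath k n).lineGraph) := by
  let φ : Fin (n + 3 * k) → Sym2 (Fin (n + 1 + 2 * k)) := fun i =>
    s(⟨edgeLo n i, (edgeLo_lt n i).trans (edgeHi_lt i.2)⟩, ⟨edgeHi n i, edgeHi_lt i.2⟩)
  have hadj : ∀ i j : Fin (n + 3 * k), i < j →
      ((L k n).Adj i j ↔ ∃ x, x ∈ φ i ∧ x ∈ φ j) := fun i j h => by
    have h : i.val < j.val := h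
    simp only [φ, Sym2.exists_mem_mem_iff, Fin.ext_iff, ← L_adj_iff_edge hk hn h j.2, L,
      fromRel_adj]
    omega
  obtain ⟨e⟩ := nonempty_iso_lineGraph_of_sym2 (G := L k n) φ
    (fun i j h => by
      simp only [φ, Sym2.eq_iff, Fin.mk.injEq] at h
      have := edgeLo_lt n i
      have := edgeLo_lt n j
      exact Fin.ext (edge_injective hk i.2 j.2 (by omega) (by omega)))
    (fun i h => by
      have := edgeLo_lt n i
      simp [φ] at h
      omega)
    (fun i j h => by
      rcases lt_or_gt_of_ne h with h | h
      · exact hadj i j h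
      · simp only [(L k n).adj_comm i j, hadj j i h, and_comm])
  have hT : fromEdgeSet (Set.range φ) = trianglePath k n := by
    have key : ∀ x y : Fin (n + 1 + 2 * k), x.val < y.val → ((∃ i, φ i = s(x, y)) ↔
        (y.val = x.val + 1 ∨ (x.val = 0 ∧ y.val = 2) ∨
          (k = 2 ∧ x.val = n + 2 ∧ y.val = n + 4))) := by
      intro x y hxy
      rw [← exists_edge_iff hk hn hxy y.2]
      simp only [φ, Sym2.eq_iff, Fin.ext_iff]
      constructor
      · rintro ⟨i, h⟩
        have := edgeLo_lt n i
        exact ⟨i, i.2, by omega⟩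
      · rintro ⟨i, hi, h⟩
        exact ⟨⟨i, hi⟩, .inl h⟩
    have key' : ∀ x y : Fin (n + 1 + 2 * k), x < y →
        ((fromEdgeSet (Set.range φ)).Adj x y ↔ (trianglePath k n).Adj x y) := by
      intro x y h
      have hne := h.ne
      have h : x.val < y.val := h
      simp only [fromEdgeSet_adj, Set.mem_range, trianglePath, fromRel_adj, key x y h, ne_eq, hne,
        not_false_eq_true, and_true, true_and]
      exact (or_iff_left (not_edge_of_lt h)).symm
    ext x y
    rcases lt_trichotomy x y with h | rfl | h
    · exact key' x y h
    · simp
    · rw [adj_comm, key' y x h, adj_comm]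
  rw [hT] at e
  exact ⟨e⟩

theorem exists_trianglePath_iso {k n : ℕ} (hk : k = 1 ∨ k = 2) (hn : k ≤ n) :
    ∃ H : SimpleGraph ℕ, Nonempty (trianglePath k n ≃g H.lineGraph) := by
  -- The root is the path `2, …, n + 3` with two leaves `0`, `1` at vertex `2` and, if `k = 2`, two
  -- leaves `n + 4`, `n + 5` at vertex `n + 3`. The forks become the triangles.
  let c : ℕ → ℕ := fun j => if j ≤ n + 3 then j else n + 3
  let d : ℕ → ℕ := fun j => if j ≤ 1 then 2 else if j ≤ n + 3 then j + 1 else n + 5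
  have hcd : ∀ i, c i < d i := fun i => by
    simp only [c, d]; split_ifs <;> omega
  let φ : Fin (n + 1 + 2 * k) → Sym2 ℕ := fun j => s(c j, d j)
  have hadj : ∀ i j : Fin (n + 1 + 2 * k), i < j →
      ((trianglePath k n).Adj i j ↔ ∃ x, x ∈ φ i ∧ x ∈ φ j) := fun i j h => by
    have h : i.val < j.val := h
    have hj := j.2
    simp only [φ, Sym2.exists_mem_mem_iff, trianglePath, fromRel_adj, ne_eq, Fin.ext_iff, c, d]
    split_ifs <;> (try simp only [true_or, or_true, iff_true]) <;> omega
  have := nonempty_iso_lineGraph_of_sym2 φ (G := trianglePath k n) (fun i j h => ?_)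
    (fun i h => ?_) (fun i j h => ?_)
  · exact ⟨_, this⟩
  · simp only [φ, Sym2.eq_iff] at h
    have h' : c i = c j ∧ d i = d j := by
      have := hcd i; have := hcd j; omega
    refine Fin.ext ?_
    have hi := i.2
    have hj := j.2
    simp only [c, d] at h'
    split_ifs at h' <;> omega
  · have := hcd i
    simp [φ] at h
    omega
  · rcases lt_or_gt_of_ne h with h | h
    · exact hadj i j h
    · simp only [(trianglePath k n).adj_comm i j, hadj j i h, and_comm]

theorem exists_L_iso_lineGraph_lineGraph {k n : ℕ} (hk : k = 1 ∨ k = 2) (hn : k ≤ n) :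
    ∃ H : SimpleGraph ℕ, Nonempty (L k n ≃g H.lineGraph.lineGraph) := by
  obtain ⟨e⟩ := nonempty_L_iso hk hn
  obtain ⟨H, ⟨i⟩⟩ := exists_trianglePath_iso hk hn
  exact ⟨H, ⟨e.trans i.lineGraph⟩⟩

end IterLine

/-! ### Triangles and diamonds forced by vertices of degree three -/

namespace SimpleGraph

variable {V W : Type*} {H : SimpleGraph W}

/-- The edge between two adjacent vertices. -/
def Adj.edge {a b : W} (h : H.Adj a b) : H.edgeSet := ⟨s(a, b), h⟩

theorem Adj.edge_inj {a b c d : W} (h : H.Adj a b) (h' : H.Adj c d) :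
    h.edge = h'.edge ↔ a = c ∧ b = d ∨ a = d ∧ b = c :=
  Subtype.ext_iff.trans Sym2.eq_iff

theorem lineGraph_adj_edge {a b c d : W} (h : H.Adj a b) (h' : H.Adj c d) :
    H.lineGraph.Adj h.edge h'.edge ↔
      ¬ (a = c ∧ b = d ∨ a = d ∧ b = c) ∧ (a = c ∨ a = d ∨ b = c ∨ b = d) := by
  rw [lineGraph_adj_iff_exists, ← Adj.edge_inj h h', ← Sym2.exists_mem_mem_iff]
  rfl

/-- An edge with three adjacent edges has an endpoint of degree at least three. -/
theorem exists_three_neighbors {g e f k : H.edgeSet} (he : H.lineGraph.Adj g e)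
    (hf : H.lineGraph.Adj g f) (hk : H.lineGraph.Adj g k) (hef : e ≠ f) (hek : e ≠ k)
    (hfk : f ≠ k) : ∃ x y a b, g.1 = s(x, y) ∧ H.Adj x y ∧ H.Adj x a ∧ H.Adj x b ∧ y ≠ a ∧ y ≠ b ∧
      a ≠ b := by
  have key : ∀ (e f : H.edgeSet) (u v : W), e ≠ g → f ≠ g → e ≠ f → g.1 = s(u, v) → u ∈ e.1 →
      u ∈ f.1 → ∃ x y a b, g.1 = s(x, y) ∧ H.Adj x y ∧ H.Adj x a ∧ H.Adj x b ∧ y ≠ a ∧ y ≠ b ∧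
      a ≠ b := by
    rintro ⟨e, he⟩ ⟨f, hf⟩ u v heg hfg hef hg ⟨a, rfl⟩ ⟨b, rfl⟩
    refine ⟨u, v, a, b, hg, ?_, he, hf, ?_, ?_, ?_⟩
    · have := g.2
      rwa [hg] at this
    · rintro rfl; exact heg (Subtype.ext hg.symm)
    · rintro rfl; exact hfg (Subtype.ext hg.symm)
    · rintro rfl; exact hef rfl
  obtain ⟨g1, x, hx, hxe⟩ := lineGraph_adj_iff_exists.1 he
  obtain ⟨g2, y, hy, hyf⟩ := lineGraph_adj_iff_exists.1 hf
  obtain ⟨g3, z, hz, hzk⟩ := lineGraph_adj_iff_exists.1 hk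
  obtain ⟨u, v, hg⟩ : ∃ u v, g.1 = s(u, v) := by
    induction h : g.1 using Sym2.ind with
    | _ u v => exact ⟨u, v, rfl⟩
  have hg' : g.1 = s(v, u) := hg.trans Sym2.eq_swap
  rw [hg, Sym2.mem_iff] at hx hy hz
  rcases hx with rfl | rfl
  · rcases hy with rfl | rfl
    · exact key e f _ _ g1.symm g2.symm hef hg hxe hyf
    · rcases hz with rfl | rfl
      · exact key e k _ _ g1.symm g3.symm hek hg hxe hzk
      · exact key f k _ _ g2.symm g3.symm hfk hg' hyf hzk
  · rcases hy with rfl | rfl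
    · rcases hz with rfl | rfl
      · exact key f k _ _ g2.symm g3.symm hfk hg hyf hzk
      · exact key e k _ _ g1.symm g3.symm hek hg' hxe hzk
    · exact key e f _ _ g1.symm g2.symm hef hg' hxe hyf

/-- Some end `x` of `g` has three neighbours, one of them the other end of `g`. Claw-freeness at `x`
joins two of the three. -/
theorem ClawFree.exists_triangle (hH : H.ClawFree) {g e f k : H.edgeSet} (he : H.lineGraph.Adj g e)
    (hf : H.lineGraph.Adj g f) (hk : H.lineGraph.Adj g k) (hef : e ≠ f) (hek : e ≠ k)
    (hfk : f ≠ k) : ∃ x a b c, H.Adj x a ∧ H.Adj x b ∧ H.Adj x c ∧ a ≠ c ∧ b ≠ c ∧ H.Adj a b ∧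
      (g.1 = s(x, a) ∨ g.1 = s(x, b) ∨ g.1 = s(x, c)) := by
  obtain ⟨x, y, a, b, hg, xy, xa, xb, ya, yb, ab⟩ := exists_three_neighbors he hf hk hef hek hfk
  rcases hH xy xa xb ya yb ab with h | h | h
  · exact ⟨x, y, a, b, xy, xa, xb, yb, ab, h, .inl hg⟩
  · exact ⟨x, y, b, a, xy, xb, xa, ya, ab.symm, h, .inl hg⟩
  · exact ⟨x, a, b, y, xa, xb, xy, ya.symm, yb.symm, h, .inr (.inr hg)⟩

theorem Subcubic.of_iso {G : SimpleGraph V} (h : G.Subcubic) (i : G ≃g H) : H.Subcubic := by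
  intro v a b c d ha hb hc hd hab hac hbc
  have e := fun x y => (i.symm.map_adj_iff (v := x) (w := y))
  simpa using h ((e _ _).2 ha) ((e _ _).2 hb) ((e _ _).2 hc) ((e _ _).2 hd)
    (i.symm.injective.ne hab) (i.symm.injective.ne hac) (i.symm.injective.ne hbc)

/-- No third iterated line graph has maximum degree three. -/
theorem lineGraph_lineGraph_lineGraph_not_subcubic
    (h3 : H.lineGraph.lineGraph.lineGraph.Subcubic)
    {g e f k : H.lineGraph.lineGraph.edgeSet} (he : H.lineGraph.lineGraph.lineGraph.Adj g e)
    (hf : H.lineGraph.lineGraph.lineGraph.Adj g f) (hk : H.lineGraph.lineGraph.lineGraph.Adj g k)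
    (hef : e ≠ f) (hek : e ≠ k) (hfk : f ≠ k) : False := by
  obtain ⟨x, y, a, b, -, xy, xa, xb, ya, yb, ab⟩ := exists_three_neighbors he hf hk hef hek hfk
  obtain ⟨x', a', b', c', xa', xb', xc', ac', bc', ab', -⟩ :=
    H.clawFree_lineGraph.exists_triangle xy xa xb ya yb ab
  generalize H.lineGraph = X at *
  have n1 := xa'.ne
  have n2 := xb'.ne
  have n3 := xc'.ne
  have n4 := ab'.ne
  let q := xa'.edge
  let r := xb'.edge
  let p := ab'.edge
  let s := xc'.edge
  have qr : X.lineGraph.Adj q r := (lineGraph_adj_edge _ _).2 (by grind)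
  have qp : X.lineGraph.Adj q p := (lineGraph_adj_edge _ _).2 (by grind)
  have qs : X.lineGraph.Adj q s := (lineGraph_adj_edge _ _).2 (by grind)
  have rp : X.lineGraph.Adj r p := (lineGraph_adj_edge _ _).2 (by grind)
  have rs : X.lineGraph.Adj r s := (lineGraph_adj_edge _ _).2 (by grind)
  have ps : p ≠ s := by simp only [p, s, ne_eq, Adj.edge_inj]; grind
  generalize X.lineGraph = Y at *
  clear_value p q r s
  have m1 := qr.ne
  have m2 := qp.ne
  have m3 := qs.ne
  have m4 := rp.ne
  have m5 := rs.ne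
  -- In `L(Y)` the edge joining the two centres of the diamond meets its four other edges.
  have := @h3 qr.edge qp.edge qs.edge rp.edge rs.edge
  simp only [lineGraph_adj_edge, ne_eq, Adj.edge_inj] at this
  grind

end SimpleGraph

namespace IterLine

variable {W : Type*} {H : SimpleGraph W}

/-- In a line graph of a claw-free graph with maximum degree three, each vertex of degree three
lies in an induced diamond with a tip of degree two, and is not this tip. -/
theorem exists_diamond_tip (hH : H.ClawFree) (h3 : H.lineGraph.Subcubic) {g e f k : H.edgeSet}
    (he : H.lineGraph.Adj g e) (hf : H.lineGraph.Adj g f) (hk : H.lineGraph.Adj g k) (hef : e ≠ f)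
    (hek : e ≠ k) (hfk : f ≠ k) : ∃ p q r s, Diamond H.lineGraph p q r s ∧
      (∀ x, H.lineGraph.Adj p x → x = q ∨ x = r) ∧ (g = q ∨ g = r ∨ g = s) := by
  obtain ⟨x, a, b, c, xa, xb, xc, ac, bc, ab, hg⟩ := hH.exists_triangle he hf hk hef hek hfk
  have n1 := xa.ne
  have n2 := xb.ne
  have n3 := xc.ne
  have n4 := ab.ne
  have qr : H.lineGraph.Adj xa.edge xb.edge :=
    (lineGraph_adj_edge _ _).2 (by grind)
  have qp : H.lineGraph.Adj xa.edge ab.edge :=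
    (lineGraph_adj_edge _ _).2 (by grind)
  have qs : H.lineGraph.Adj xa.edge xc.edge :=
    (lineGraph_adj_edge _ _).2 (by grind)
  have rp : H.lineGraph.Adj xb.edge ab.edge :=
    (lineGraph_adj_edge _ _).2 (by grind)
  have rs : H.lineGraph.Adj xb.edge xc.edge :=
    (lineGraph_adj_edge _ _).2 (by grind)
  refine ⟨ab.edge, xa.edge, xb.edge, xc.edge,
    ⟨qp.symm, rp.symm, qr, qs, rs, ?_, ?_⟩, ?_, ?_⟩
  rotate_left 3
  · exact hg.imp Subtype.ext (Or.imp Subtype.ext Subtype.ext)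
  · rw [lineGraph_adj_edge]; grind
  · simp only [ne_eq, Adj.edge_inj]; grind
  · rintro ⟨y, hy⟩ h
    obtain ⟨hne, z, hz, hzy⟩ := lineGraph_adj_iff_exists.1 h
    obtain ⟨w, rfl⟩ := hzy
    have hy' : H.Adj z w := hy
    have hzw := hy'.ne
    change ¬ ab.edge = hy'.edge at hne
    change hy'.edge = xa.edge ∨ hy'.edge = xb.edge
    change z ∈ s(a, b) at hz
    simp only [Sym2.mem_iff, Adj.edge_inj] at hz hne ⊢
    -- A further edge at `a` would be a fourth neighbour of `xa`, besides `xb`, `ab` and `xc`;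
    -- likewise at `b` for `xb`.
    rcases hz with rfl | rfl
    · by_contra hn
      have hqy : H.lineGraph.Adj xa.edge hy'.edge :=
        (lineGraph_adj_edge _ _).2 (by grind)
      have := h3 qr qp qs hqy
      simp only [ne_eq, Adj.edge_inj] at this
      grind
    · by_contra hn
      have hry : H.lineGraph.Adj xb.edge hy'.edge :=
        (lineGraph_adj_edge _ _).2 (by grind)
      have := h3 qr.symm rp rs hry
      simp only [ne_eq, Adj.edge_inj] at this
      grind

end IterLine

/-! ### Growing a path from a diamond: the classification by `L k n` -/

namespace IterLine

variable {V : Type*} {G : SimpleGraph V}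

/-- The hypothesis `h` describes whole neighbourhoods, so the enumerated set is closed under
adjacency and, by connectedness, is everything. Values of `v` from `n + 3 * k` on are irrelevant. -/
theorem nonempty_iso_L_of_enum (hc : G.Connected) {k n : ℕ} (hk : 1 ≤ k) (v : ℕ → V)
    (hinj : ∀ i < n + 3 * k, ∀ j < n + 3 * k, v i = v j → i = j)
    (h : ∀ i < n + 3 * k, ∀ w, G.Adj (v i) w ↔ ∃ j < n + 3 * k, w = v j ∧ (i ≠ j ∧
      ((j = i + 1 ∨ (i = 0 ∧ j = 2) ∨ (i = 1 ∧ j = 3) ∨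
        (k = 2 ∧ ((i = n + 2 ∧ j = n + 4) ∨ (i = n + 3 ∧ j = n + 5)))) ∨
      (i = j + 1 ∨ (j = 0 ∧ i = 2) ∨ (j = 1 ∧ i = 3) ∨
        (k = 2 ∧ ((j = n + 2 ∧ i = n + 4) ∨ (j = n + 3 ∧ i = n + 5))))))) :
    Nonempty (G ≃g L k n) := by
  have hsurj := hc.mem_of_closed (S := {w | ∃ i < n + 3 * k, v i = w}) (a := v 0)
    ⟨0, by omega, rfl⟩ (by
      rintro _ ⟨i, hi, rfl⟩ w hw
      obtain ⟨j, hj, rfl, -⟩ := (h i hi w).1 hw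
      exact ⟨j, hj, rfl⟩)
  refine ⟨Iso.symm ⟨Equiv.ofBijective (fun i : Fin (n + 3 * k) => v i) ⟨?_, ?_⟩, ?_⟩⟩
  · intro i j e
    exact Fin.ext (hinj i i.2 j j.2 e)
  · intro w
    obtain ⟨i, hi, rfl⟩ := hsurj w
    exact ⟨⟨i, hi⟩, rfl⟩
  · intro i j
    change G.Adj (v i) (v j) ↔ _
    rw [h i i.2, L, fromRel_adj, ne_eq, Fin.ext_iff]
    constructor
    · rintro ⟨j', hj', e, hr⟩
      rw [hinj j j.2 j' hj' e]
      exact hr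
    · exact fun hr => ⟨j, j.2, rfl, hr⟩

/-- Adjacency in the infinite path with a diamond at its end. -/
def Step (i j : ℕ) : Prop :=
  (j = i + 1 ∨ (i = 0 ∧ j = 2) ∨ (i = 1 ∧ j = 3)) ∨
    (i = j + 1 ∨ (j = 0 ∧ i = 2) ∨ (j = 1 ∧ i = 3))

/-- The first `m` values of `v` form a diamond followed by a path, which leaves no other
neighbours to the vertices before the last one. -/
structure DiamondPath (G : SimpleGraph V) (m : ℕ) (v : ℕ → V) : Prop where
  four_le : 4 ≤ m
  inj : ∀ i < m, ∀ j < m, v i = v j → i = j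
  adj : ∀ i, i + 1 < m → ∀ w, G.Adj (v i) w ↔ ∃ j, Step i j ∧ w = v j

theorem DiamondPath.of_diamond {p q r s : V} (h3 : G.Subcubic) (d : Diamond G p q r s)
    (t : ∀ x, G.Adj p x → x = q ∨ x = r) :
    DiamondPath G 4 fun i => if i = 0 then p else if i = 1 then q else if i = 2 then r else s := by
  have npq := d.pq.ne
  have npr := d.pr.ne
  have nqr := d.qr.ne
  have nqs := d.qs.ne
  have nrs := d.rs.ne
  have ne := d.ne
  refine ⟨le_rfl, fun i hi j hj e => ?_, fun i hi w => ?_⟩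
  · interval_cases i <;> interval_cases j <;> simp_all
  · have : i = 0 ∨ i = 1 ∨ i = 2 := by omega
    rcases this with rfl | rfl | rfl
    · constructor
      · intro h
        rcases t w h with rfl | rfl
        exacts [⟨1, by simp [Step], by simp⟩, ⟨2, by simp [Step], by simp⟩]
      · rintro ⟨j, hj, rfl⟩
        have : j = 1 ∨ j = 2 := by simp only [Step] at hj; omega
        rcases this with rfl | rfl
        exacts [by simpa using d.pq, by simpa using d.pr]
    · constructor
      · intro h
        rcases h3 d.pq.symm d.qr d.qs (by simpa using h) npr ne nrs with rfl | rfl | rfl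
        exacts [⟨0, by simp [Step], by simp⟩, ⟨2, by simp [Step], by simp⟩,
          ⟨3, by simp [Step], by simp⟩]
      · rintro ⟨j, hj, rfl⟩
        have : j = 0 ∨ j = 2 ∨ j = 3 := by simp only [Step] at hj; omega
        rcases this with rfl | rfl | rfl
        exacts [by simpa using d.pq.symm, by simpa using d.qr, by simpa using d.qs]
    · constructor
      · intro h
        rcases h3 d.pr.symm d.qr.symm d.rs (by simpa using h) npq ne nqs with rfl | rfl | rfl
        exacts [⟨0, by simp [Step], by simp⟩, ⟨1, by simp [Step], by simp⟩,
          ⟨3, by simp [Step], by simp⟩]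
      · rintro ⟨j, hj, rfl⟩
        have : j = 0 ∨ j = 1 ∨ j = 3 := by simp only [Step] at hj; omega
        rcases this with rfl | rfl | rfl
        exacts [by simpa using d.pr.symm, by simpa using d.qr.symm, by simpa using d.rs]

theorem step_iff_one {n i j : ℕ} : Step i j ↔ i ≠ j ∧
    ((j = i + 1 ∨ (i = 0 ∧ j = 2) ∨ (i = 1 ∧ j = 3) ∨
        (1 = 2 ∧ ((i = n + 2 ∧ j = n + 4) ∨ (i = n + 3 ∧ j = n + 5)))) ∨
      (i = j + 1 ∨ (j = 0 ∧ i = 2) ∨ (j = 1 ∧ i = 3) ∨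
        (1 = 2 ∧ ((j = n + 2 ∧ i = n + 4) ∨ (j = n + 3 ∧ i = n + 5))))) := by
  simp only [Step, OfNat.one_ne_ofNat, false_and, or_false]
  omega

theorem step_iff_two {m n i j : ℕ} (hn : m = n + 3) :
    Step i j ∨ i = m - 1 ∧ j = m + 1 ∨ i = m ∧ j = m + 2 ∨ j = m - 1 ∧ i = m + 1 ∨
      j = m ∧ i = m + 2 ↔ i ≠ j ∧
    ((j = i + 1 ∨ (i = 0 ∧ j = 2) ∨ (i = 1 ∧ j = 3) ∨
        (2 = 2 ∧ ((i = n + 2 ∧ j = n + 4) ∨ (i = n + 3 ∧ j = n + 5)))) ∨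
      (i = j + 1 ∨ (j = 0 ∧ i = 2) ∨ (j = 1 ∧ i = 3) ∨
        (2 = 2 ∧ ((j = n + 2 ∧ i = n + 4) ∨ (j = n + 3 ∧ i = n + 5))))) := by
  subst hn
  simp only [Step, true_and, show n + 3 - 1 = n + 2 from rfl]
  constructor
  · rintro (((h | h | h) | (h | h | h)) | h | h | h | h) <;> refine ⟨by omega, ?_⟩ <;> simp [h]
  · rintro ⟨-, (h | h | h | h | h) | (h | h | h | h | h)⟩ <;> simp [h]

theorem Step.symm {i j : ℕ} (h : Step i j) : Step j i := Or.symm h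

namespace DiamondPath

variable {m : ℕ} {v : ℕ → V}

theorem adj_iff (h : DiamondPath G m v) {i j : ℕ} (hi : i + 1 < m) (hj : j < m) :
    G.Adj (v i) (v j) ↔ Step i j := by
  have := h.four_le
  rw [h.adj i hi]
  constructor
  · rintro ⟨j', hs, e⟩
    rwa [h.inj j hj j' (by simp only [Step] at hs; omega) e]
  · exact fun hs => ⟨j, hs, rfl⟩

theorem last_adj_iff (h : DiamondPath G m v) {j : ℕ} (hj : j < m) :
    G.Adj (v (m - 1)) (v j) ↔ Step (m - 1) j := by
  have := h.four_le
  by_cases e : j = m - 1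
  · subst e
    simp only [SimpleGraph.irrefl, Step, false_iff]
    omega
  · rw [G.adj_comm, h.adj_iff (by omega) (by omega)]
    exact ⟨Step.symm, Step.symm⟩

theorem le_card [Finite V] (h : DiamondPath G m v) : m ≤ Nat.card V := by
  have : Function.Injective fun i : Fin m => v i := fun i j e => Fin.ext (h.inj i i.2 j j.2 e)
  simpa using Nat.card_le_card_of_injective _ this

/-- If the last vertex has no further neighbours, then the graph is `L 1 n`. -/
theorem nonempty_iso_one (h : DiamondPath G m v) (hc : G.Connected)
    (hlast : ∀ w, G.Adj (v (m - 1)) w → ∃ i < m, w = v i) : Nonempty (G ≃g L 1 (m - 3)) := by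
  have hm := h.four_le
  have e : m - 3 + 3 * 1 = m := by omega
  refine nonempty_iso_L_of_enum hc le_rfl v
    (fun i hi j hj => h.inj i (by omega) j (by omega)) fun i hi w => ?_
  have key : G.Adj (v i) w ↔ ∃ j < m, w = v j ∧ Step i j := by
    by_cases hi' : i + 1 < m
    · rw [h.adj i hi']
      refine exists_congr fun j => ⟨fun hj => ⟨?_, hj.2, hj.1⟩, fun hj => ⟨hj.2.2, hj.2.1⟩⟩
      have := hj.1
      simp only [Step] at this
      omega
    · obtain rfl : i = m - 1 := by omega
      constructor
      · intro hw
        obtain ⟨j, hj, rfl⟩ := hlast w hw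
        exact ⟨j, hj, rfl, (h.last_adj_iff hj).1 hw⟩
      · rintro ⟨j, hj, rfl, hs⟩
        exact (h.last_adj_iff hj).2 hs
  exact key.trans (exists_congr fun j => and_congr (by omega)
    (and_congr_right fun _ => step_iff_one))

/-- If the last vertex has exactly one further neighbour, the path can be prolonged. -/
theorem snoc (h : DiamondPath G m v) {t : V} (ht : ∀ i < m, t ≠ v i) (hadj : G.Adj (v (m - 1)) t)
    (hlast : ∀ w, G.Adj (v (m - 1)) w → w = t ∨ ∃ i < m, w = v i) :
    DiamondPath G (m + 1) fun i => if i = m then t else v i := by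
  have hm := h.four_le
  refine ⟨by omega, fun i hi j hj e => ?_, fun i hi w => ?_⟩
  · by_cases h1 : i = m <;> by_cases h2 : j = m <;> simp only [h1, h2, if_true, if_false] at e ⊢
    · exact absurd e (ht j (by omega))
    · exact absurd e.symm (ht i (by omega))
    · exact h.inj i (by omega) j (by omega) e
  · have hne : i ≠ m := by omega
    simp only [hne, if_false]
    by_cases hi' : i + 1 < m
    · rw [h.adj i hi']
      refine exists_congr fun j => and_congr_right fun hs => ?_
      have : j ≠ m := by simp only [Step] at hs; omega
      simp [this]
    · obtain rfl : i = m - 1 := by omega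
      constructor
      · intro hw
        rcases hlast w hw with rfl | ⟨j, hj, rfl⟩
        · exact ⟨m, by simp only [Step]; omega, by simp⟩
        · exact ⟨j, (h.last_adj_iff hj).1 hw, by simp [hj.ne]⟩
      · rintro ⟨j, hs, rfl⟩
        by_cases hj : j = m
        · simpa [hj] using hadj
        · simp only [hj, if_false]
          refine (h.last_adj_iff ?_).2 hs
          simp only [Step] at hs
          omega

/-- If the path ends in the tip of another diamond, the graph is `L 2 n`. -/
theorem nonempty_iso_two (h : DiamondPath G m v) (hc : G.Connected) (h3 : G.Subcubic)
    (hm : 5 ≤ m) {p q r : V} (d : Diamond G p q r (v (m - 1)))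
    (t : ∀ x, G.Adj p x → x = q ∨ x = r) (hp : ∀ i < m, p ≠ v i) (hq : ∀ i < m, q ≠ v i)
    (hr : ∀ i < m, r ≠ v i) : Nonempty (G ≃g L 2 (m - 3)) := by
  have npq := d.pq.ne
  have npr := d.pr.ne
  have nqr := d.qr.ne
  have e : m - 3 + 3 * 2 = m + 3 := by omega
  -- With `n = m - 3`, the last path vertex `m - 1` is `n + 2`. The second diamond continues with
  -- its centres `q`, `r` and ends with the degree-two tip `p`, matching the numbering of `L 2 n`.
  let v' : ℕ → V := fun i => if i < m then v i else if i = m then q else if i = m + 1 then r else p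
  have v0 : ∀ i < m, v' i = v i := fun i hi => by simp [v', hi]
  have v1 : v' m = q := by simp [v']
  have v2 : v' (m + 1) = r := by simp [v']
  have v3 : v' (m + 2) = p := by simp [v']
  clear_value v'
  have hz : G.Adj (v (m - 1)) (v (m - 2)) := (h.last_adj_iff (by omega)).2 (by
    simp only [Step]; omega)
  have cases : ∀ i < m + 3, i < m ∧ v' i = v i ∨ i = m ∧ v' i = q ∨ i = m + 1 ∧ v' i = r ∨
      i = m + 2 ∧ v' i = p := fun i hi => by
    have : i < m ∨ m = i ∨ i = m + 1 ∨ i = m + 2 := by omega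
    rcases this with h | rfl | rfl | rfl <;> simp [*]
  have key : ∀ i < m + 3, ∀ w, G.Adj (v' i) w ↔ ∃ j < m + 3, w = v' j ∧
      (Step i j ∨ i = m - 1 ∧ j = m + 1 ∨ i = m ∧ j = m + 2 ∨ j = m - 1 ∧ i = m + 1 ∨
        j = m ∧ i = m + 2) := by
    intro i hi w
    have : i + 1 < m ∨ i = m - 1 ∨ m = i ∨ i = m + 1 ∨ i = m + 2 := by omega
    rcases this with h1 | rfl | rfl | rfl | rfl
    · rw [v0 i (by omega), h.adj i h1]
      constructor
      · rintro ⟨j, hs, rfl⟩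
        have : j < m := by simp only [Step] at hs; omega
        exact ⟨j, by omega, (v0 j this).symm, .inl hs⟩
      · rintro ⟨j, hj, rfl, hs⟩
        have : Step i j := by simp only [Step] at hs ⊢; omega
        have hjm : j < m := by simp only [Step] at this; omega
        exact ⟨j, this, v0 j hjm⟩
    · rw [v0 (m - 1) (by omega)]
      constructor
      · intro hw
        rcases h3 d.qs.symm d.rs.symm hz hw nqr (hq _ (by omega)) (hr _ (by omega)) with
          rfl | rfl | rfl
        · exact ⟨m, by omega, v1.symm, by simp only [Step]; omega⟩
        · exact ⟨m + 1, by omega, v2.symm, by simp⟩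
        · exact ⟨m - 2, by omega, (v0 _ (by omega)).symm, by simp only [Step]; omega⟩
      · rintro ⟨j, hj, rfl, hs⟩
        have : j = m - 2 ∨ j = m ∨ j = m + 1 := by simp only [Step] at hs; omega
        rcases this with rfl | rfl | rfl
        · rwa [v0 (m - 2) (by omega)]
        · rw [v1]; exact d.qs.symm
        · rw [v2]; exact d.rs.symm
    · rw [v1]
      constructor
      · intro hw
        rcases h3 d.pq.symm d.qr d.qs hw npr d.ne d.rs.ne with rfl | rfl | rfl
        · exact ⟨m + 2, by omega, v3.symm, by simp⟩
        · exact ⟨m + 1, by omega, v2.symm, by simp [Step]⟩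
        · exact ⟨m - 1, by omega, (v0 _ (by omega)).symm, by simp only [Step]; omega⟩
      · rintro ⟨j, hj, rfl, hs⟩
        have : j = m - 1 ∨ j = m + 1 ∨ j = m + 2 := by simp only [Step] at hs; omega
        rcases this with rfl | rfl | rfl
        · rw [v0 (m - 1) (by omega)]; exact d.qs
        · rw [v2]; exact d.qr
        · rw [v3]; exact d.pq.symm
    · rw [v2]
      constructor
      · intro hw
        rcases h3 d.pr.symm d.qr.symm d.rs hw npq d.ne d.qs.ne with rfl | rfl | rfl
        · exact ⟨m + 2, by omega, v3.symm, by simp [Step]⟩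
        · exact ⟨m, by omega, v1.symm, by simp [Step]⟩
        · exact ⟨m - 1, by omega, (v0 _ (by omega)).symm, by simp⟩
      · rintro ⟨j, hj, rfl, hs⟩
        have : j = m - 1 ∨ j = m ∨ j = m + 2 := by simp only [Step] at hs; omega
        rcases this with rfl | rfl | rfl
        · rw [v0 (m - 1) (by omega)]; exact d.rs
        · rw [v1]; exact d.qr.symm
        · rw [v3]; exact d.pr.symm
    · rw [v3]
      constructor
      · intro hw
        rcases t w hw with rfl | rfl
        · exact ⟨m, by omega, v1.symm, by simp⟩
        · exact ⟨m + 1, by omega, v2.symm, by simp [Step]⟩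
      · rintro ⟨j, hj, rfl, hs⟩
        have : j = m ∨ j = m + 1 := by simp only [Step] at hs; omega
        rcases this with rfl | rfl
        · rw [v1]; exact d.pq
        · rw [v2]; exact d.pr
  refine nonempty_iso_L_of_enum hc (by omega) v' ?_ ?_
  · intro i hi j hj e
    rcases cases i (by omega) with ⟨h1, e1⟩ | ⟨h1, e1⟩ | ⟨h1, e1⟩ | ⟨h1, e1⟩ <;>
      rcases cases j (by omega) with ⟨h2, e2⟩ | ⟨h2, e2⟩ | ⟨h2, e2⟩ | ⟨h2, e2⟩ <;>
      rw [e1, e2] at e <;> first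
      | exact h.inj i h1 j h2 e
      | exact h1.trans h2.symm
      | exact absurd e ‹_›
      | exact absurd e.symm ‹_›
      | exact absurd e.symm (hp i h1)
      | exact absurd e.symm (hq i h1)
      | exact absurd e.symm (hr i h1)
      | exact absurd e (hp j h2)
      | exact absurd e (hq j h2)
      | exact absurd e (hr j h2)
  · intro i hi w
    exact (key i (by omega) w).trans (exists_congr fun j => and_congr (by omega)
      (and_congr_right fun _ => step_iff_two (by omega)))

end DiamondPath

/-- Take a longest diamond path. If its last vertex has no neighbour off the path, the graph is `L 1
n`; exactly one would prolong the path. With two, the last vertex has degree three, so `hd` places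
it in a diamond, and it can only be the tip opposite the degree-two tip. -/
theorem exists_nonempty_iso_L [Finite V] (hc : G.Connected) (h3 : G.Subcubic)
    (hd : ∀ g e f k, G.Adj g e → G.Adj g f → G.Adj g k → e ≠ f → e ≠ k → f ≠ k →
      ∃ p q r s, Diamond G p q r s ∧ (∀ x, G.Adj p x → x = q ∨ x = r) ∧ (g = q ∨ g = r ∨ g = s))
    {g e f k : V} (he : G.Adj g e) (hf : G.Adj g f) (hk : G.Adj g k) (hef : e ≠ f) (hek : e ≠ k)
    (hfk : f ≠ k) : ∃ k n : ℕ, (k = 1 ∨ k = 2) ∧ k ≤ n ∧ Nonempty (G ≃g L k n) := by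
  obtain ⟨m, ⟨v, hv⟩, hmax⟩ : ∃ m, (∃ v, DiamondPath G m v) ∧ ¬ ∃ v, DiamondPath G (m + 1) v := by
    by_contra! hn
    have : ∀ m, ∃ v, DiamondPath G (m + 4) v := by
      intro m
      induction m with
      | zero =>
        obtain ⟨p, q, r, s, d, t, -⟩ := hd g e f k he hf hk hef hek hfk
        exact ⟨_, .of_diamond h3 d t⟩
      | succ m ih => exact hn _ ih
    obtain ⟨v, hv⟩ := this (Nat.card V)
    have := hv.le_card
    omega
  have hm := hv.four_le
  by_cases h1 : ∀ w, G.Adj (v (m - 1)) w → ∃ i < m, w = v i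
  · exact ⟨1, m - 3, .inl rfl, by omega, hv.nonempty_iso_one hc h1⟩
  push Not at h1
  obtain ⟨t₁, ut₁, ht₁⟩ := h1
  by_cases h2 : ∀ w, G.Adj (v (m - 1)) w → w = t₁ ∨ ∃ i < m, w = v i
  · exact absurd ⟨_, hv.snoc ht₁ ut₁ h2⟩ hmax
  push Not at h2
  obtain ⟨t₂, ut₂, ht, ht₂⟩ := h2
  -- For `m = 4` the last vertex already has two neighbours in the first diamond, so it has room for
  -- only one more.
  have h5 : 5 ≤ m := by
    by_contra hlt
    obtain rfl : m = 4 := by omega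
    have a1 : G.Adj (v 3) (v 1) := (hv.last_adj_iff (by omega)).2 (by simp [Step])
    have a2 : G.Adj (v 3) (v 2) := (hv.last_adj_iff (by omega)).2 (by simp [Step])
    have := h3 a1 a2 ut₁ ut₂ (fun e => by simpa using hv.inj 1 (by omega) 2 (by omega) e)
      (ht₁ 1 (by omega)).symm (ht₁ 2 (by omega)).symm
    rcases this with e | e | e
    exacts [ht₂ 1 (by omega) e, ht₂ 2 (by omega) e, ht e]
  have hz : G.Adj (v (m - 1)) (v (m - 2)) := (hv.last_adj_iff (by omega)).2 (by
    simp only [Step]; omega)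
  have hcommon : ∀ w, G.Adj (v (m - 1)) w → ¬ G.Adj (v (m - 2)) w := by
    intro w h1 h2
    obtain ⟨j, hs, rfl⟩ := (hv.adj (m - 2) (by omega) w).1 h2
    have := (hv.last_adj_iff (j := j) (by simp only [Step] at hs; omega)).1 h1
    simp only [Step] at this hs
    omega
  have hold : ∀ w, G.Adj (v (m - 1)) w → w ≠ v (m - 2) → ∀ i < m, w ≠ v i := by
    rintro _ hw hne i hi rfl
    have := (hv.last_adj_iff hi).1 hw
    have : i = m - 2 := by simp only [Step] at this; omega
    exact hne (by rw [this])
  obtain ⟨p, q, r, s, d, t, hu⟩ := hd _ _ _ _ hz ut₁ ut₂ (ht₁ _ (by omega)).symm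
    (ht₂ _ (by omega)).symm (Ne.symm ht)
  -- Every edge at a centre of the diamond lies in a triangle, whereas by `hcommon` the last edge of
  -- the path lies in none.
  have hus : s = v (m - 1) := by
    rcases hu with hu | hu | hu
    · rw [hu] at hz hcommon
      exfalso
      rcases h3 d.pq.symm d.qr d.qs hz d.pr.ne d.ne d.rs.ne with e | e | e
      · exact hcommon r d.qr (e ▸ d.pr)
      · exact hcommon p d.pq.symm (e ▸ d.pr.symm)
      · exact hcommon r d.qr (e ▸ d.rs.symm)
    · rw [hu] at hz hcommon
      exfalso
      rcases h3 d.pr.symm d.qr.symm d.rs hz d.pq.ne d.ne d.qs.ne with e | e | e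
      · exact hcommon q d.qr.symm (e ▸ d.pq)
      · exact hcommon p d.pr.symm (e ▸ d.pq.symm)
      · exact hcommon q d.qr.symm (e ▸ d.qs.symm)
    · exact hu.symm
  subst hus
  have hq := hold q d.qs.symm (fun e => hcommon r d.rs.symm (e ▸ d.qr))
  have hr := hold r d.rs.symm (fun e => hcommon q d.qs.symm (e ▸ d.qr.symm))
  refine ⟨2, m - 3, .inr rfl, by omega, hv.nonempty_iso_two hc h3 h5 d t ?_ hq hr⟩
  rintro i hi rfl
  have hi' : i ≠ m - 1 := by rintro rfl; exact d.ne rfl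
  obtain ⟨j, hs, e⟩ := (hv.adj i (by omega) q).1 d.pq
  exact hq j (by simp only [Step] at hs; omega) e

end IterLine

/-! ### Degree conditions and assembly -/

theorem SimpleGraph.subcubic_of_maxDegree_le {V : Type*} [Fintype V] (G : SimpleGraph V)
    [DecidableRel G.Adj] (h : G.maxDegree ≤ 3) : G.Subcubic := by
  classical
  intro v a b c d ha hb hc hd hab hac hbc
  by_contra! hn
  have hsub : ({d, a, b, c} : Finset V) ⊆ G.neighborFinset v := by
    intro x hx
    simp only [Finset.mem_insert, Finset.mem_singleton] at hx
    rw [mem_neighborFinset]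
    rcases hx with rfl | rfl | rfl | rfl <;> assumption
  have h1 := Finset.card_le_card hsub
  rw [Finset.card_insert_of_notMem (by simp [hn]), Finset.card_insert_of_notMem (by simp [hab, hac]),
    Finset.card_pair hbc, card_neighborFinset_eq_degree] at h1
  have := G.degree_le_maxDegree v
  omega

theorem SimpleGraph.exists_three_of_maxDegree {V : Type*} [Fintype V] [Nonempty V]
    (G : SimpleGraph V) [DecidableRel G.Adj] (h : G.maxDegree = 3) :
    ∃ g e f k, G.Adj g e ∧ G.Adj g f ∧ G.Adj g k ∧ e ≠ f ∧ e ≠ k ∧ f ≠ k := by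
  classical
  obtain ⟨g, hg⟩ := G.exists_maximal_degree_vertex
  rw [h, ← card_neighborFinset_eq_degree] at hg
  obtain ⟨e, f, k, h1, h2, h4, h5⟩ := Finset.card_eq_three.1 hg.symm
  have key : ∀ x, G.Adj g x ↔ x = e ∨ x = f ∨ x = k := fun x => by
    rw [← mem_neighborFinset, h5]
    simp
  exact ⟨g, e, f, k, by simp [key], by simp [key], by simp [key], h1, h2, h4⟩

theorem mainTheorem4 {V : Type*} [Fintype V] (G : SimpleGraph V) [DecidableRel G.Adj]
    (hconn : G.Connected) (hdeg : G.maxDegree = 3)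
    (hG₂ : ¬ Nonempty (G ≃g IterLine.G₂)) :
    List.TFAE [
      IterLine.IsIterLineGraph 1 G,
      IterLine.IsIterLineGraphOfConnected 1 G,
      ¬ IterLine.G₁.IsIndContained G ∧ ¬ IterLine.G₄.IsIndContained G ∧
        ¬ IterLine.G₇.IsIndContained G] ∧
    List.TFAE [
      IterLine.IsIterLineGraph 2 G,
      IterLine.IsIterLineGraphOfConnected 2 G,
      ∃ k n : ℕ, (k = 1 ∨ k = 2) ∧ k ≤ n ∧ Nonempty (G ≃g IterLine.L k n)] ∧
    ∀ n : ℕ, 3 ≤ n → ¬ IterLine.IsIterLineGraph n G := by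
  have h3 := G.subcubic_of_maxDegree_le hdeg.le
  have := hconn.nonempty
  obtain ⟨g, e, f, k, he, hf, hk, hef, hek, hfk⟩ := G.exists_three_of_maxDegree hdeg
  refine ⟨?_, ?_, ?_⟩
  · tfae_have 2 → 1 := fun ⟨W, hW, H, _, h⟩ => ⟨W, hW, H, h⟩
    tfae_have 1 → 3 := by
      rintro ⟨W, hW, H, ⟨i⟩⟩
      have i : G ≃g H.lineGraph := i
      exact ⟨(clawFree_iff G).1 (H.clawFree_lineGraph.of_embedding i.toEmbedding),
        IterLine.not_G₄_of_lineGraph i, IterLine.not_G₇_of_lineGraph i⟩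
    tfae_have 3 → 2 := by
      rintro ⟨h1, h4, h7⟩
      obtain ⟨H, h⟩ := IterLine.exists_iso_lineGraph_of_forbidden hconn ((clawFree_iff G).2 h1) h3
        hG₂ h4 h7
      exact IterLine.isIterLineGraphOfConnected_one hconn h
    tfae_finish
  · tfae_have 2 → 1 := fun ⟨W, hW, H, _, h⟩ => ⟨W, hW, H, h⟩
    tfae_have 1 → 3 := by
      rintro ⟨W, hW, H, ⟨i⟩⟩
      have i : G ≃g H.lineGraph.lineGraph := i
      have : Finite H.lineGraph.edgeSet := Finite.of_equiv V i.toEquiv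
      have h3' := h3.of_iso i
      -- The diamonds come from claw-freeness of `L(H)`, applied to its line graph.
      obtain ⟨k, n, hk, hn, ⟨j⟩⟩ := IterLine.exists_nonempty_iso_L (i.connected_iff.1 hconn) h3'
        (fun _ _ _ _ => IterLine.exists_diamond_tip H.clawFree_lineGraph h3')
        (i.map_adj_iff.2 he) (i.map_adj_iff.2 hf) (i.map_adj_iff.2 hk) (i.injective.ne hef)
        (i.injective.ne hek) (i.injective.ne hfk)
      exact ⟨k, n, hk, hn, ⟨i.trans j⟩⟩
    tfae_have 3 → 2 := by
      rintro ⟨k, n, hk, hn, ⟨i⟩⟩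
      obtain ⟨H, ⟨j⟩⟩ := IterLine.exists_L_iso_lineGraph_lineGraph hk hn
      exact IterLine.isIterLineGraphOfConnected_two hconn ⟨i.trans j⟩
    tfae_finish
  · rintro n hn ⟨W, hW, H, ⟨i⟩⟩
    obtain ⟨m, rfl⟩ := Nat.exists_eq_add_of_le' hn
    have i : G ≃g (IterLine.iterLineGraph H m).lineGraph.lineGraph.lineGraph := i
    exact lineGraph_lineGraph_lineGraph_not_subcubic (h3.of_iso i) (i.map_adj_iff.2 he)
      (i.map_adj_iff.2 hf) (i.map_adj_iff.2 hk) (i.injective.ne hef) (i.injective.ne hek)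
      (i.injective.ne hfk)
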